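/- All vector spaces are over $\mathbb{C}$, and $\mathbb{Z}_+=\{0,1,2,\dots\}$. For $N\in\mathbb{Z}_+\cup\{\infty\}$ let $\mathbb{C}^N$ be the space with basis $e_1,e_2,\dots$ ($N$ vectors, countably many if $N=\infty$), and let $\mathfrak{gl}_N$ be the Lie algebra of $N\times N$ matrices with finitely many nonzero entries, acting on $\mathbb{C}^N$. Let $\mathrm{Rep}(\mathfrak{gl}_N)_{poly}$ be the full subcategory of $\mathfrak{gl}_N$-modules consisting of the direct summands of finite direct sums of tensor powers $(\mathbb{C}^N)^{\otimes d}$, $d\ge 0$. Let $\mathrm{Rep}(S_d)$ be the category of finite-dimensional representations of the symmetric group $S_d$, and let $\bigoplus_{d}\mathrm{Rep}(S_d)$ be the category whose objects are families $(X_d)_{d\in\mathbb{Z}_+}$, $X_d\in\mathrm{Rep}(S_d)$, with $X_d=0$ for all but finitely many $d$, and whose morphisms are families of morphisms. The group $S_d$ acts on $(\mathbb{C}^N)^{\otimes d}$ by $\sigma(v_1\otimes\cdots\otimes v_d)=v_{\sigma^{-1}(1)}\otimes\cdots\otimes v_{\sigma^{-1}(d)}$, and the Schur–Weyl functor is the contravariant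 functor $$SW_{N}:\bigoplus_{d}\mathrm{Rep}(S_d)\to \mathrm{Rep}(\mathfrak{gl}_N)_{poly},\qquad SW_{N}\big((X_d)_d\big)=\bigoplus_d \mathrm{Hom}_{S_d}\big(X_d,(\mathbb{C}^N)^{\otimes d}\big).$$ For $n\ge 0$ let $\mathfrak{gl}_n^{\perp}\subset\mathfrak{gl}_{n+1}$ consist of the matrices $(a_{ij})$ with $a_{ij}=0$ whenever $i\le n$ or $j\le n$, and let $\mathrm{Res}_{n,n+1}:\mathrm{Rep}(\mathfrak{gl}_{n+1})_{poly}\to\mathrm{Rep}(\mathfrak{gl}_n)_{poly}$ be the functor $M\mapsto M^{\mathfrak{gl}_n^\perp}$ of invariants. The inverse limit of these categories has as objects the sequences $(M_n)_{n\ge 0}$, $M_n\in\mathrm{Rep}(\mathfrak{gl}_n)_{poly}$, together with isomorphisms $\mathrm{Res}_{n,n+1}(M_{n+1})\cong M_n$, and as morphisms the sequences of morphisms compatible with these isomorphisms. The restricted inverse limit $\varprojlim_{n,\,restr}\mathrm{Rep}(\mathfrak{gl}_n)_{poly}$ is its full subcategory of objects for which the lengths of the $M_n$ are bounded. The inclusions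 $\mathbb{C}^n\subset\mathbb{C}^{n+1}$ induce natural isomorphisms $\mathrm{Res}_{n,n+1}\circ SW_{n+1}\cong SW_{n}$, so the functors $SW_{n}$, $n\ge 0$, define a contravariant functor $SW_{\lim}$ from $\bigoplus_d\mathrm{Rep}(S_d)$ to the inverse limit. **Proposition.** The categories $\bigoplus_{d}\mathrm{Rep}(S_d)$, $\mathrm{Rep}(\mathfrak{gl}_\infty)_{poly}$ and $\varprojlim_{n,\,restr}\mathrm{Rep}(\mathfrak{gl}_n)_{poly}$ are semisimple (abelian, with every object a finite direct sum of simple objects). The functor $SW_{\lim}$ takes values in the restricted inverse limit, and the contravariant $\mathbb{C}$-linear functors $$SW_\infty:\bigoplus_{d}\mathrm{Rep}(S_d)\to \mathrm{Rep}(\mathfrak{gl}_\infty)_{poly},\qquad SW_{\lim}:\bigoplus_{d}\mathrm{Rep}(S_d)\to \varprojlim_{n,\,restr}\mathrm{Rep}(\mathfrak{gl}_n)_{poly}$$ are anti-equivalences of categories. -/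

import Mathlib

open CategoryTheory CategoryTheory.Limits
open scoped TensorProduct DirectSum

noncomputable section

namespace SchurWeyl

attribute [local instance] LieRing.ofAssociativeRing

/-! ### The Lie algebra of finitary matrices and its tensor representations -/

/-- The Lie algebra `𝔤𝔩_N` of square matrices with rows and columns indexed by `ι` and finitely many
nonzero entries, realised as endomorphisms of the space `ι →₀ ℂ` with basis `ι`. For `ι = Fin n` the
finiteness condition is void, and for `ι = ℕ` this is `𝔤𝔩_∞`. -/
def gl (ι : Type) : LieSubalgebra ℂ (Module.End ℂ (ι →₀ ℂ)) where
  carrier := {A | {p : ι × ι | A (Finsupp.single p.2 1) p.1 ≠ 0}.Finite}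
  zero_mem' := by simp
  add_mem' {A B} hA hB := by
    refine (Set.Finite.union hA hB).subset fun p hp => ?_
    by_contra h
    simp only [Set.mem_union, Set.mem_ofPred_eq, not_or, not_not] at h
    exact hp (by simp [h.1, h.2])
  smul_mem' c A hA := by
    refine Set.Finite.subset hA fun p hp h => hp ?_
    simp [h]
  lie_mem' {A B} hA hB := by
    have key : ∀ A B : Module.End ℂ (ι →₀ ℂ),
        {p : ι × ι | A (Finsupp.single p.2 1) p.1 ≠ 0}.Finite →
        {p : ι × ι | B (Finsupp.single p.2 1) p.1 ≠ 0}.Finite →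
        {p : ι × ι | (A * B) (Finsupp.single p.2 1) p.1 ≠ 0}.Finite := by
      intro A B hA hB
      refine ((hA.image Prod.fst).prod (hB.image Prod.snd)).subset fun p hp => ?_
      have h1 : (A * B) (Finsupp.single p.2 1) p.1 =
          (B (Finsupp.single p.2 1)).sum fun k c => c * A (Finsupp.single k 1) p.1 := by
        conv_lhs => rw [Module.End.mul_apply, ← Finsupp.sum_single (B (Finsupp.single p.2 1))]
        rw [map_finsuppSum, Finsupp.sum_apply]
        refine Finsupp.sum_congr fun k _ => ?_
        rw [← mul_one (B (Finsupp.single p.2 1) k), ← smul_eq_mul, ← Finsupp.smul_single, map_smul]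
        simp
      have hp' : (A * B) (Finsupp.single p.2 1) p.1 ≠ 0 := hp
      rw [h1] at hp'
      obtain ⟨k, hk, hne⟩ := Finset.exists_ne_zero_of_sum_ne_zero hp'
      exact ⟨⟨(p.1, k), right_ne_zero_of_mul hne, rfl⟩, ⟨(k, p.2), left_ne_zero_of_mul hne, rfl⟩⟩
    refine ((key A B hA hB).union (key B A hB hA)).subset fun p hp => ?_
    by_contra h
    simp only [Set.mem_union, Set.mem_ofPred_eq, not_or, not_not] at h
    exact hp (by
      rw [LieRing.of_associative_ring_bracket, LinearMap.sub_apply, Finsupp.sub_apply, h.1, h.2, sub_zero])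

/-- The tensor power `(ℂ^N)^{⊗ d}`. -/
abbrev TPow (ι : Type) (d : ℕ) : Type := ⨂[ℂ] _ : Fin d, (ι →₀ ℂ)

section Tensor

variable {V W : Type} [AddCommGroup V] [Module ℂ V] [AddCommGroup W] [Module ℂ W] {d : ℕ}

/-- The operator `1 ⊗ ⋯ ⊗ A ⊗ ⋯ ⊗ 1` with `A` in position `k`. -/
def tensorAt (k : Fin d) (A : Module.End ℂ V) : Module.End ℂ (⨂[ℂ] _ : Fin d, V) :=
  PiTensorProduct.map (Function.update (fun _ => LinearMap.id) k A)

/-- The action of `A` on `V^{⊗ d}` by the Leibniz rule. -/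
def tensorDeriv (d : ℕ) (A : Module.End ℂ V) : Module.End ℂ (⨂[ℂ] _ : Fin d, V) :=
  ∑ k, tensorAt k A

lemma tensorAt_tprod (k : Fin d) (A : Module.End ℂ V) (v : Fin d → V) :
    tensorAt k A (PiTensorProduct.tprod ℂ v) =
      PiTensorProduct.tprod ℂ (Function.update v k (A (v k))) := by
  rw [tensorAt, PiTensorProduct.map_tprod]
  congr 1
  funext j
  by_cases h : j = k
  · subst h; simp
  · simp [h]

lemma tensorDeriv_tprod (A : Module.End ℂ V) (v : Fin d → V) :
    tensorDeriv d A (PiTensorProduct.tprod ℂ v) =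
      ∑ k, PiTensorProduct.tprod ℂ (Function.update v k (A (v k))) := by
  simp [tensorDeriv, tensorAt_tprod]

lemma tensorAt_mul (k : Fin d) (A B : Module.End ℂ V) :
    tensorAt k (A * B) = tensorAt k A * tensorAt k B := by
  refine PiTensorProduct.ext (MultilinearMap.ext fun v => ?_)
  simp [tensorAt_tprod]

lemma tensorAt_comm {k l : Fin d} (h : k ≠ l) (A B : Module.End ℂ V) :
    tensorAt k A * tensorAt l B = tensorAt l B * tensorAt k A := by
  refine PiTensorProduct.ext (MultilinearMap.ext fun v => ?_)
  simp [tensorAt_tprod, h, h.symm, Function.update_comm h]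

lemma tensorAt_add (k : Fin d) (A B : Module.End ℂ V) :
    tensorAt k (A + B) = tensorAt k A + tensorAt k B :=
  PiTensorProduct.map_update_add _ _ _ _

lemma tensorAt_smul (k : Fin d) (c : ℂ) (A : Module.End ℂ V) :
    tensorAt k (c • A) = c • tensorAt k A :=
  PiTensorProduct.map_update_smul _ _ _ _

lemma tensorDeriv_add (A B : Module.End ℂ V) :
    tensorDeriv d (A + B) = tensorDeriv d A + tensorDeriv d B := by
  simp [tensorDeriv, tensorAt_add, Finset.sum_add_distrib]

lemma tensorDeriv_smul (c : ℂ) (A : Module.End ℂ V) :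
    tensorDeriv d (c • A) = c • tensorDeriv d A := by
  simp [tensorDeriv, tensorAt_smul, Finset.smul_sum]

lemma tensorDeriv_lie (A B : Module.End ℂ V) :
    tensorDeriv d ⁅A, B⁆ = tensorDeriv d A * tensorDeriv d B - tensorDeriv d B * tensorDeriv d A := by
  have hsub : ∀ k : Fin d, tensorAt k ⁅A, B⁆ =
      tensorAt k A * tensorAt k B - tensorAt k B * tensorAt k A := by
    intro k
    have := tensorAt_add k ⁅A, B⁆ (B * A)
    rw [LieRing.of_associative_ring_bracket, sub_add_cancel, tensorAt_mul, tensorAt_mul] at this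
    rw [this, LieRing.of_associative_ring_bracket, add_sub_cancel_right]
  simp only [tensorDeriv, hsub, Finset.sum_mul_sum]
  conv_rhs => rw [Finset.sum_comm (f := fun i j => tensorAt i B * tensorAt j A)]
  rw [← Finset.sum_sub_distrib]
  refine Finset.sum_congr rfl fun k _ => ?_
  rw [← Finset.sum_sub_distrib, Finset.sum_eq_single k]
  · intro l _ hl
    rw [tensorAt_comm hl.symm, sub_self]
  · simp

/-- The tensor power of a linear map. -/
def tensorMap (d : ℕ) (g : V →ₗ[ℂ] W) : (⨂[ℂ] _ : Fin d, V) →ₗ[ℂ] ⨂[ℂ] _ : Fin d, W :=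
  PiTensorProduct.map fun _ => g

lemma tensorMap_tensorDeriv (g : V →ₗ[ℂ] W) (A : Module.End ℂ V) (B : Module.End ℂ W)
    (h : ∀ v, g (A v) = B (g v)) (t : ⨂[ℂ] _ : Fin d, V) :
    tensorMap d g (tensorDeriv d A t) = tensorDeriv d B (tensorMap d g t) := by
  suffices tensorMap d g ∘ₗ tensorDeriv d A = tensorDeriv d B ∘ₗ tensorMap d g from
    LinearMap.congr_fun this t
  refine PiTensorProduct.ext (MultilinearMap.ext fun v => ?_)
  simp only [LinearMap.compMultilinearMap_apply, LinearMap.comp_apply, tensorDeriv_tprod, tensorMap,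
    map_sum, PiTensorProduct.map_tprod]
  refine Finset.sum_congr rfl fun k _ => ?_
  congr 1
  funext j
  by_cases hj : j = k
  · subst hj; simp [h]
  · simp [hj]

end Tensor

variable {ι κ : Type} {d : ℕ}

/-- The Lie algebra action on `(ℂ^N)^{⊗ d}`. -/
instance : LieRingModule (gl ι) (TPow ι d) where
  bracket A t := tensorDeriv d A.1 t
  add_lie A B t := by
    change tensorDeriv d (A.1 + B.1) t = _
    rw [tensorDeriv_add]; rfl
  lie_add A s t := map_add _ _ _
  leibniz_lie A B t := by
    change tensorDeriv d A.1 (tensorDeriv d B.1 t) =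
      tensorDeriv d ⁅A.1, B.1⁆ t + tensorDeriv d B.1 (tensorDeriv d A.1 t)
    rw [tensorDeriv_lie]
    exact (sub_add_cancel (tensorDeriv d A.1 (tensorDeriv d B.1 t))
      (tensorDeriv d B.1 (tensorDeriv d A.1 t))).symm

lemma lie_tpow (A : gl ι) (t : TPow ι d) : ⁅A, t⁆ = tensorDeriv d A.1 t := rfl

instance : LieModule ℂ (gl ι) (TPow ι d) where
  smul_lie c A t := by
    change tensorDeriv d (c • A.1) t = _
    rw [tensorDeriv_smul]; rfl
  lie_smul c A t := map_smul _ _ _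

/-- The permutation of tensor factors
`v₁ ⊗ ⋯ ⊗ v_d ↦ v_{σ⁻¹ 1} ⊗ ⋯ ⊗ v_{σ⁻¹ d}`. -/
def permMap (ι : Type) {d : ℕ} (σ : Equiv.Perm (Fin d)) : TPow ι d →ₗ[ℂ] TPow ι d :=
  (PiTensorProduct.reindex ℂ (fun _ => ι →₀ ℂ) σ).toLinearMap

lemma permMap_tprod (σ : Equiv.Perm (Fin d)) (v : Fin d → ι →₀ ℂ) :
    permMap ι σ (PiTensorProduct.tprod ℂ v) = PiTensorProduct.tprod ℂ fun k => v (σ⁻¹ k) :=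
  PiTensorProduct.reindex_tprod _ _

/-- The action of `S_d` on the space `(ℂ^N)^{⊗ d}` by permuting the factors. -/
def permTPow (ι : Type) (d : ℕ) : Representation ℂ (Equiv.Perm (Fin d)) (TPow ι d) where
  toFun σ := permMap ι σ
  map_one' := by
    refine PiTensorProduct.ext (MultilinearMap.ext fun v => ?_)
    simp [permMap_tprod]
  map_mul' σ τ := by
    refine PiTensorProduct.ext (MultilinearMap.ext fun v => ?_)
    simp [permMap_tprod]

lemma permTPow_tprod (σ : Equiv.Perm (Fin d)) (v : Fin d → ι →₀ ℂ) :
    permTPow ι d σ (PiTensorProduct.tprod ℂ v) = PiTensorProduct.tprod ℂ fun k => v (σ⁻¹ k) :=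
  permMap_tprod σ v

lemma permTPow_tensorDeriv (σ : Equiv.Perm (Fin d)) (A : Module.End ℂ (ι →₀ ℂ)) (t : TPow ι d) :
    tensorDeriv d A (permTPow ι d σ t) = permTPow ι d σ (tensorDeriv d A t) := by
  suffices tensorDeriv d A ∘ₗ permTPow ι d σ = permTPow ι d σ ∘ₗ tensorDeriv d A from
    LinearMap.congr_fun this t
  refine PiTensorProduct.ext (MultilinearMap.ext fun v => ?_)
  simp only [LinearMap.compMultilinearMap_apply, LinearMap.comp_apply, permTPow_tprod,
    tensorDeriv_tprod, map_sum]
  refine Fintype.sum_equiv σ⁻¹ _ _ fun k => ?_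
  congr 1
  funext j
  by_cases hj : j = k
  · subst hj; simp
  · simp [hj]

lemma permTPow_tensorMap (σ : Equiv.Perm (Fin d)) (g : (ι →₀ ℂ) →ₗ[ℂ] (κ →₀ ℂ)) (t : TPow ι d) :
    tensorMap d g (permTPow ι d σ t) = permTPow κ d σ (tensorMap d g t) := by
  suffices tensorMap d g ∘ₗ permTPow ι d σ = permTPow κ d σ ∘ₗ tensorMap d g from
    LinearMap.congr_fun this t
  refine PiTensorProduct.ext (MultilinearMap.ext fun v => ?_)
  simp [permTPow_tprod, tensorMap]

/-! ### Representations and polynomial representations -/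

/-- Representations of a complex Lie algebra `L`. -/
structure LieRep (L : Type) [LieRing L] [LieAlgebra ℂ L] where
  carrier : Type
  [addCommGroup : AddCommGroup carrier]
  [module : Module ℂ carrier]
  [lieRingModule : LieRingModule L carrier]
  [lieModule : LieModule ℂ L carrier]

attribute [instance] LieRep.addCommGroup LieRep.module LieRep.lieRingModule LieRep.lieModule

section LieRepCat

variable (L : Type) [LieRing L] [LieAlgebra ℂ L]

/-- Morphisms are the `L`-equivariant linear maps. -/
instance : Category (LieRep L) where
  Hom M N := M.carrier →ₗ⁅ℂ, L⁆ N.carrier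
  id M := LieModuleHom.id
  comp f g := LieModuleHom.comp g f

instance : Preadditive (LieRep L) where
  homGroup M N := inferInstanceAs (AddCommGroup (M.carrier →ₗ⁅ℂ, L⁆ N.carrier))
  add_comp M N K f f' g := LieModuleHom.ext fun m =>
    map_add (show N.carrier →ₗ⁅ℂ, L⁆ K.carrier from g) ((show M.carrier →ₗ⁅ℂ, L⁆ N.carrier from f) m)
      ((show M.carrier →ₗ⁅ℂ, L⁆ N.carrier from f') m)
  comp_add _ _ _ _ _ _ := rfl

instance : Linear ℂ (LieRep L) where
  homModule M N := inferInstanceAs (Module ℂ (M.carrier →ₗ⁅ℂ, L⁆ N.carrier))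
  smul_comp M N K c f g := LieModuleHom.ext fun m =>
    map_smul (show N.carrier →ₗ⁅ℂ, L⁆ K.carrier from g) c
      ((show M.carrier →ₗ⁅ℂ, L⁆ N.carrier from f) m)
  comp_smul _ _ _ _ _ _ := rfl

end LieRepCat

/-- The representation `(ℂ^N)^{⊗ d}` of `𝔤𝔩_N`. -/
def tensorRep (ι : Type) (d : ℕ) : LieRep (gl ι) := ⟨TPow ι d⟩

/-- A representation of `𝔤𝔩_N` is polynomial if it is a direct summand of a finite direct sum of tensor
powers of the tautological representation. -/
def IsPolynomial (ι : Type) : ObjectProperty (LieRep (gl ι)) := fun M =>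
  ∃ (J : Type) (_ : Finite J) (d : J → ℕ)
    (i : M.carrier →ₗ⁅ℂ, gl ι⁆ ⨁ j, (tensorRep ι (d j)).carrier)
    (p : (⨁ j, (tensorRep ι (d j)).carrier) →ₗ⁅ℂ, gl ι⁆ M.carrier), ∀ m, p (i m) = m

/-- The category `Rep(𝔤𝔩_N)_poly`. -/
abbrev RepPoly (ι : Type) : Type 1 := (IsPolynomial ι).FullSubcategory

lemma lieModuleHom_sum_apply {L M N J : Type} [LieRing L] [LieAlgebra ℂ L] [AddCommGroup M] [Module ℂ M]
    [LieRingModule L M] [LieModule ℂ L M] [AddCommGroup N] [Module ℂ N] [LieRingModule L N]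
    [LieModule ℂ L N] (s : Finset J) (f : J → M →ₗ⁅ℂ, L⁆ N) (m : M) :
    (∑ j ∈ s, f j) m = ∑ j ∈ s, f j m := by
  classical
  induction s using Finset.induction_on with
  | empty => simp
  | insert j s hj ih => rw [Finset.sum_insert hj, Finset.sum_insert hj, LieModuleHom.add_apply, ih]

lemma isPolynomial_of_sum_aux (M : LieRep (gl ι)) {J : Type} [Fintype J] (d : J → ℕ)
    (i : ∀ j, M.carrier →ₗ⁅ℂ, gl ι⁆ (tensorRep ι (d j)).carrier)
    (p : ∀ j, (tensorRep ι (d j)).carrier →ₗ⁅ℂ, gl ι⁆ M.carrier)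
    (h : ∀ m, ∑ j, p j (i j m) = m) : IsPolynomial ι M := by
  classical
  refine ⟨J, inferInstance, d,
    ∑ j, (DirectSum.lieModuleOf ℂ J (gl ι) (fun j => (tensorRep ι (d j)).carrier) j).comp (i j),
    ∑ j, (p j).comp
      (DirectSum.lieModuleComponent ℂ J (gl ι) (fun j => (tensorRep ι (d j)).carrier) j), fun m => ?_⟩
  rw [lieModuleHom_sum_apply]
  refine (Finset.sum_congr rfl fun j _ => ?_).trans (h m)
  refine congrArg (p j) ?_
  rw [lieModuleHom_sum_apply, map_sum, Finset.sum_eq_single j]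
  · exact DirectSum.component.lof_self ℂ (M := fun j => (tensorRep ι (d j)).carrier) j (i j m)
  · intro k _ hk
    exact (DirectSum.component.of (R := ℂ) (M := fun j => (tensorRep ι (d j)).carrier) j k
      (i k m)).trans (dif_neg hk)
  · simp

lemma isPolynomial_of_sum (M : LieRep (gl ι)) {J : Type} [Fintype J] (d : J → ℕ)
    (i : ∀ j, M.carrier →ₗ⁅ℂ, gl ι⁆ TPow ι (d j)) (p : ∀ j, TPow ι (d j) →ₗ⁅ℂ, gl ι⁆ M.carrier)
    (h : ∀ m, ∑ j, p j (i j m) = m) : IsPolynomial ι M :=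
  isPolynomial_of_sum_aux M d i p h

lemma IsPolynomial.exists_sum_aux {M : LieRep (gl ι)} (hM : IsPolynomial ι M) :
    ∃ (J : Type) (_ : Fintype J) (d : J → ℕ)
      (i : ∀ j, M.carrier →ₗ⁅ℂ, gl ι⁆ (tensorRep ι (d j)).carrier)
      (p : ∀ j, (tensorRep ι (d j)).carrier →ₗ⁅ℂ, gl ι⁆ M.carrier), ∀ m, ∑ j, p j (i j m) = m := by
  classical
  obtain ⟨J, hJ, d, i, p, h⟩ := hM
  have := Fintype.ofFinite J
  refine ⟨J, this, d, fun j => (DirectSum.lieModuleComponent ℂ J (gl ι)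
      (fun j => (tensorRep ι (d j)).carrier) j).comp i,
    fun j => p.comp (DirectSum.lieModuleOf ℂ J (gl ι) (fun j => (tensorRep ι (d j)).carrier) j),
    fun m => ?_⟩
  refine Eq.trans ?_ (h m)
  refine Eq.trans (map_sum p (fun j => DirectSum.lieModuleOf ℂ J (gl ι)
    (fun j => (tensorRep ι (d j)).carrier) j (i m j)) Finset.univ).symm ?_
  exact congrArg p (DirectSum.sum_univ_of (i m))

lemma IsPolynomial.exists_sum {M : LieRep (gl ι)} (hM : IsPolynomial ι M) :
    ∃ (J : Type) (_ : Fintype J) (d : J → ℕ) (i : ∀ j, M.carrier →ₗ⁅ℂ, gl ι⁆ TPow ι (d j))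
      (p : ∀ j, TPow ι (d j) →ₗ⁅ℂ, gl ι⁆ M.carrier), ∀ m, ∑ j, p j (i j m) = m :=
  hM.exists_sum_aux

/-! ### Restriction functors -/

/-- The inclusion `ℂ^κ → ℂ^ι` along `e`. -/
def incl (e : κ ↪ ι) : (κ →₀ ℂ) →ₗ[ℂ] (ι →₀ ℂ) := Finsupp.lmapDomain ℂ ℂ e

/-- The coordinate projection `ℂ^ι → ℂ^κ` along `e`. -/
def proj (e : κ ↪ ι) : (ι →₀ ℂ) →ₗ[ℂ] (κ →₀ ℂ) := Finsupp.lcomapDomain e e.injective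

lemma proj_apply (e : κ ↪ ι) (v : ι →₀ ℂ) (k : κ) : proj e v k = v (e k) := rfl

lemma incl_apply (e : κ ↪ ι) (v : κ →₀ ℂ) (k : κ) : incl e v (e k) = v k :=
  Finsupp.mapDomain_apply e.injective v k

lemma incl_apply_of_notMem (e : κ ↪ ι) (v : κ →₀ ℂ) {i : ι} (hi : i ∉ Set.range e) :
    incl e v i = 0 :=
  Finsupp.mapDomain_of_notMem_range v i hi

lemma incl_single (e : κ ↪ ι) (k : κ) : incl e (Finsupp.single k 1) = Finsupp.single (e k) 1 :=
  Finsupp.mapDomain_single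

lemma proj_incl (e : κ ↪ ι) (v : κ →₀ ℂ) : proj e (incl e v) = v := by
  ext k
  rw [proj_apply, incl_apply]

lemma proj_single (e : κ ↪ ι) (k : κ) : proj e (Finsupp.single (e k) 1) = Finsupp.single k 1 := by
  rw [← incl_single, proj_incl]

lemma proj_single_of_notMem (e : κ ↪ ι) {i : ι} (hi : i ∉ Set.range e) :
    proj e (Finsupp.single i 1) = 0 := by
  ext k
  rw [proj_apply, Finsupp.single_eq_of_ne fun h => hi ⟨k, h⟩]
  rfl

/-- The inclusion `𝔤𝔩_κ ⊆ 𝔤𝔩_ι` by zero rows and columns outside the range of `e`. -/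
def glIncl (e : κ ↪ ι) (A : gl κ) : gl ι :=
  ⟨incl e ∘ₗ A.1 ∘ₗ proj e, by
    refine (Set.Finite.image (Prod.map e e) A.2).subset fun p hp => ?_
    have hp' : incl e (A.1 (proj e (Finsupp.single p.2 1))) p.1 ≠ 0 := hp
    by_cases h2 : p.2 ∈ Set.range e
    · by_cases h1 : p.1 ∈ Set.range e
      · obtain ⟨k, hk⟩ := h1
        obtain ⟨l, hl⟩ := h2
        rw [← hk, ← hl, incl_apply, proj_single] at hp'
        exact ⟨(k, l), hp', Prod.ext hk hl⟩
      · exact absurd (incl_apply_of_notMem e _ h1) hp'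
    · rw [proj_single_of_notMem e h2, map_zero, map_zero] at hp'
      exact absurd rfl hp'⟩

lemma glIncl_val (e : κ ↪ ι) (A : gl κ) (v : ι →₀ ℂ) :
    (glIncl e A).1 v = incl e (A.1 (proj e v)) := rfl

lemma glIncl_add (e : κ ↪ ι) (A B : gl κ) : glIncl e (A + B) = glIncl e A + glIncl e B := by
  refine Subtype.ext (LinearMap.ext fun v => ?_)
  exact map_add (incl e) (A.1 (proj e v)) (B.1 (proj e v))

lemma glIncl_smul (e : κ ↪ ι) (c : ℂ) (A : gl κ) : glIncl e (c • A) = c • glIncl e A := by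
  refine Subtype.ext (LinearMap.ext fun v => ?_)
  exact map_smul (incl e) c (A.1 (proj e v))

lemma glIncl_lie (e : κ ↪ ι) (A B : gl κ) : glIncl e ⁅A, B⁆ = ⁅glIncl e A, glIncl e B⁆ := by
  refine Subtype.ext (LinearMap.ext fun v => ?_)
  change incl e (A.1 (B.1 (proj e v)) - B.1 (A.1 (proj e v))) =
    incl e (A.1 (proj e (incl e (B.1 (proj e v))))) - incl e (B.1 (proj e (incl e (A.1 (proj e v)))))
  rw [proj_incl, proj_incl, map_sub]

/-- The set `𝔤𝔩_κ^⊥ ⊆ 𝔤𝔩_ι` of matrices `(a_{ij})` such that `a_{ij} = 0` whenever `i` or `j` lies in the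
range of `e`. -/
def glPerp (e : κ ↪ ι) : Set (gl ι) :=
  {A | ∀ i j, i ∈ Set.range e ∨ j ∈ Set.range e → A.1 (Finsupp.single j 1) i = 0}

lemma glPerp_incl (e : κ ↪ ι) {A : gl ι} (hA : A ∈ glPerp e) (v : κ →₀ ℂ) : A.1 (incl e v) = 0 := by
  induction v using Finsupp.induction_linear with
  | zero => simp
  | add v w hv hw => rw [map_add, map_add, hv, hw, add_zero]
  | single k c =>
    rw [← mul_one c, ← smul_eq_mul, ← Finsupp.smul_single, map_smul, map_smul, incl_single]
    have : A.1 (Finsupp.single (e k) 1) = 0 := by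
      ext i
      exact hA i (e k) (Or.inr ⟨k, rfl⟩)
    rw [this, smul_zero]

lemma proj_glPerp (e : κ ↪ ι) {A : gl ι} (hA : A ∈ glPerp e) (v : ι →₀ ℂ) : proj e (A.1 v) = 0 := by
  induction v using Finsupp.induction_linear with
  | zero => simp
  | add v w hv hw => rw [map_add, map_add, hv, hw, add_zero]
  | single i c =>
    rw [← mul_one c, ← smul_eq_mul, ← Finsupp.smul_single, map_smul, map_smul]
    have : proj e (A.1 (Finsupp.single i 1)) = 0 := by
      ext k
      exact hA (e k) i (Or.inl ⟨k, rfl⟩)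
    rw [this, smul_zero]

lemma glPerp_lie (e : κ ↪ ι) (A : gl κ) {B : gl ι} (hB : B ∈ glPerp e) : ⁅B, glIncl e A⁆ = 0 := by
  refine Subtype.ext (LinearMap.ext fun v => ?_)
  change B.1 (incl e (A.1 (proj e v))) - incl e (A.1 (proj e (B.1 v))) = 0
  rw [glPerp_incl e hB, proj_glPerp e hB, map_zero, map_zero, sub_zero]

/-- The invariants `M^{𝔤𝔩_κ^⊥}`. -/
def invariants (e : κ ↪ ι) (M : Type) [AddCommGroup M] [Module ℂ M] [LieRingModule (gl ι) M]
    [LieModule ℂ (gl ι) M] : Submodule ℂ M where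
  carrier := {m | ∀ B ∈ glPerp e, ⁅B, m⁆ = 0}
  zero_mem' B _ := lie_zero B
  add_mem' {m m'} hm hm' B hB := by rw [lie_add, hm B hB, hm' B hB, add_zero]
  smul_mem' c m hm B hB := by rw [lie_smul, hm B hB, smul_zero]

section Invariants

variable (e : κ ↪ ι) {M N : Type} [AddCommGroup M] [Module ℂ M] [LieRingModule (gl ι) M]
  [LieModule ℂ (gl ι) M] [AddCommGroup N] [Module ℂ N] [LieRingModule (gl ι) N]
  [LieModule ℂ (gl ι) N]

/-- `𝔤𝔩_κ` acts on the invariants through the inclusion `𝔤𝔩_κ ⊆ 𝔤𝔩_ι`. -/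
instance : LieRingModule (gl κ) (invariants e M) where
  bracket A m := ⟨⁅glIncl e A, m.1⁆, fun B hB => by
    rw [leibniz_lie, glPerp_lie e A hB, zero_lie, m.2 B hB, lie_zero, add_zero]⟩
  add_lie A B m := Subtype.ext <| by
    change ⁅glIncl e (A + B), m.1⁆ = ⁅glIncl e A, m.1⁆ + ⁅glIncl e B, m.1⁆
    rw [glIncl_add, add_lie]
  lie_add A m m' := Subtype.ext <| lie_add (glIncl e A) m.1 m'.1
  leibniz_lie A B m := Subtype.ext <| by
    change ⁅glIncl e A, ⁅glIncl e B, m.1⁆⁆ = ⁅glIncl e ⁅A, B⁆, m.1⁆ + ⁅glIncl e B, ⁅glIncl e A, m.1⁆⁆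
    rw [glIncl_lie, leibniz_lie]

lemma invariants_lie (A : gl κ) (m : invariants e M) : (⁅A, m⁆ : invariants e M).1 = ⁅glIncl e A, m.1⁆ :=
  rfl

instance : LieModule ℂ (gl κ) (invariants e M) where
  smul_lie c A m := Subtype.ext <| by
    change ⁅glIncl e (c • A), m.1⁆ = c • ⁅glIncl e A, m.1⁆
    rw [glIncl_smul, smul_lie]
  lie_smul c A m := Subtype.ext <| lie_smul c (glIncl e A) m.1

/-- The map induced on invariants. -/
def invariantsMap (f : M →ₗ⁅ℂ, gl ι⁆ N) : invariants e M →ₗ⁅ℂ, gl κ⁆ invariants e N where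
  toFun m := ⟨f m.1, fun B hB => by rw [← LieModuleHom.map_lie, m.2 B hB, map_zero]⟩
  map_add' m m' := Subtype.ext (map_add f m.1 m'.1)
  map_smul' c m := Subtype.ext (map_smul f c m.1)
  map_lie' {A m} := Subtype.ext (LieModuleHom.map_lie f (glIncl e A) m.1)

end Invariants

section TensorInvariants

variable (e : κ ↪ ι)

/-- The projection `(ℂ^ι)^{⊗ d} → (ℂ^κ)^{⊗ d}`. -/
def tproj (d : ℕ) : TPow ι d →ₗ[ℂ] TPow κ d := tensorMap d (proj e)

/-- The inclusion `(ℂ^κ)^{⊗ d} → (ℂ^ι)^{⊗ d}`. -/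
def tincl (d : ℕ) : TPow κ d →ₗ[ℂ] TPow ι d := tensorMap d (incl e)

lemma tproj_lie (A : gl κ) (t : TPow ι d) : tproj e d ⁅glIncl e A, t⁆ = ⁅A, tproj e d t⁆ :=
  tensorMap_tensorDeriv _ _ _ (fun v => by rw [glIncl_val, proj_incl]) t

lemma tincl_lie (A : gl κ) (t : TPow κ d) : tincl e d ⁅A, t⁆ = ⁅glIncl e A, tincl e d t⁆ :=
  tensorMap_tensorDeriv _ _ _ (fun v => by rw [glIncl_val, proj_incl]) t

lemma tproj_tincl (t : TPow κ d) : tproj e d (tincl e d t) = t := by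
  suffices tproj e d ∘ₗ tincl e d = LinearMap.id from LinearMap.congr_fun this t
  refine PiTensorProduct.ext (MultilinearMap.ext fun v => ?_)
  simp [tproj, tincl, tensorMap, proj_incl]

lemma glPerp_tincl {B : gl ι} (hB : B ∈ glPerp e) (t : TPow κ d) : ⁅B, tincl e d t⁆ = 0 := by
  rw [lie_tpow, tincl, ← tensorMap_tensorDeriv (incl e) 0 B.1
    (fun v => by rw [glPerp_incl e hB, LinearMap.zero_apply, map_zero])]
  have : tensorDeriv d (0 : Module.End ℂ (κ →₀ ℂ)) = 0 := by
    have h := tensorDeriv_smul (d := d) 0 (0 : Module.End ℂ (κ →₀ ℂ))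
    rwa [zero_smul, zero_smul] at h
  rw [this, LinearMap.zero_apply, map_zero]

/-- The diagonal matrix unit `E_{aa}`. -/
def diagUnit (a : ι) : gl ι :=
  ⟨Finsupp.lsingle a ∘ₗ Finsupp.lapply a, by
    refine (Set.finite_singleton (a, a)).subset fun p hp => ?_
    have hp' : Finsupp.single a ((Finsupp.single p.2 (1 : ℂ)) a) p.1 ≠ 0 := hp
    by_contra h
    apply hp'
    by_cases h1 : a = p.1
    · by_cases h2 : p.2 = a
      · exact absurd (Prod.ext h1.symm h2) h
      · rw [Finsupp.single_eq_of_ne (Ne.symm h2), Finsupp.single_zero, Finsupp.zero_apply]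
    · rw [Finsupp.single_eq_of_ne (Ne.symm h1)]⟩

lemma diagUnit_single (a i : ι) [Decidable (i = a)] :
    (diagUnit a).1 (Finsupp.single i 1) = if i = a then Finsupp.single i 1 else 0 := by
  change Finsupp.single a ((Finsupp.single i (1 : ℂ)) a) = _
  split_ifs with h
  · subst h; simp
  · rw [Finsupp.single_eq_of_ne (Ne.symm h), Finsupp.single_zero]

lemma diagUnit_mem {a : ι} (ha : a ∉ Set.range e) : diagUnit a ∈ glPerp e := by
  classical
  intro i j hij
  rw [diagUnit_single]
  split_ifs with h
  · subst h
    rcases hij with hi | hj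
    · exact Finsupp.single_eq_of_ne fun h => ha (h ▸ hi)
    · exact absurd hj ha
  · rfl

/-- A tensor invariant under `𝔤𝔩_κ^⊥` lies in the image of `(ℂ^κ)^{⊗ d}`. -/
lemma tincl_tproj (t : TPow ι d) (ht : ∀ B ∈ glPerp e, ⁅B, t⁆ = 0) : tincl e d (tproj e d t) = t := by
  classical
  let b := Basis.piTensorProduct fun _ : Fin d => (Finsupp.basisSingleOne : Module.Basis ι ℂ (ι →₀ ℂ))
  have hb : ∀ w, b w = PiTensorProduct.tprod ℂ fun k => Finsupp.single (w k) 1 := fun w => by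
    rw [Basis.piTensorProduct_apply]; simp
  have hdiag : ∀ (a : ι) (w : Fin d → ι) (s : TPow ι d), b.repr ⁅diagUnit a, s⁆ w =
      ((Finset.univ.filter fun k => w k = a).card : ℂ) * b.repr s w := by
    intro a w s
    suffices b.coord w ∘ₗ tensorDeriv d (diagUnit a).1 =
        ((Finset.univ.filter fun k => w k = a).card : ℂ) • b.coord w from LinearMap.congr_fun this s
    refine b.ext fun u => ?_
    have h1 : tensorDeriv d (diagUnit a).1 (b u) =
        ((Finset.univ.filter fun k => u k = a).card : ℂ) • b u := by
      rw [hb, tensorDeriv_tprod, Finset.card_filter, Nat.cast_sum, Finset.sum_smul]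
      refine Finset.sum_congr rfl fun k _ => ?_
      rw [diagUnit_single]
      split_ifs with h
      · rw [Function.update_eq_self (f := fun k => Finsupp.single (u k) (1 : ℂ)) k]; simp
      · rw [MultilinearMap.map_update_zero]; simp
    rw [LinearMap.comp_apply, h1, map_smul, LinearMap.smul_apply, b.coord_apply, b.repr_self,
      Finsupp.single_apply]
    split_ifs with h
    · rw [h]
    · simp
  have hpi : ∀ (w : Fin d → ι) (s : TPow ι d), b.repr (tincl e d (tproj e d s)) w =
      if ∀ k, w k ∈ Set.range e then b.repr s w else 0 := by
    intro w s
    suffices b.coord w ∘ₗ tincl e d ∘ₗ tproj e d =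
        (if ∀ k, w k ∈ Set.range e then (1 : ℂ) else 0) • b.coord w by
      have h := LinearMap.congr_fun this s
      rw [LinearMap.smul_apply] at h
      refine h.trans ?_
      split_ifs <;> simp
    refine b.ext fun u => ?_
    have h1 : tincl e d (tproj e d (b u)) = (if ∀ k, u k ∈ Set.range e then (1 : ℂ) else 0) • b u := by
      rw [hb, tincl, tproj, tensorMap, tensorMap, PiTensorProduct.map_tprod, PiTensorProduct.map_tprod]
      split_ifs with h
      · rw [one_smul]
        congr 1
        funext k
        obtain ⟨l, hl⟩ := h k
        rw [← hl, proj_single, incl_single]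
      · push Not at h
        obtain ⟨k, hk⟩ := h
        rw [zero_smul]
        exact MultilinearMap.map_coord_zero _ k (by
          rw [proj_single_of_notMem e hk, map_zero])
    rw [LinearMap.comp_apply, LinearMap.comp_apply, h1, map_smul, LinearMap.smul_apply, b.coord_apply,
      b.repr_self, Finsupp.single_apply]
    split_ifs <;> simp_all
  refine b.ext_elem fun w => ?_
  rw [hpi]
  split_ifs with h
  · rfl
  · push Not at h
    obtain ⟨k, hk⟩ := h
    have h0 := hdiag (w k) w t
    rw [ht _ (diagUnit_mem e hk), map_zero, Finsupp.zero_apply] at h0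
    rcases mul_eq_zero.mp h0.symm with h | h
    · rw [Nat.cast_eq_zero, Finset.card_eq_zero, Finset.filter_eq_empty_iff] at h
      exact absurd rfl (h (Finset.mem_univ k))
    · exact h.symm

end TensorInvariants

/-- The functor `M ↦ M^{𝔤𝔩_κ^⊥}` on all representations. -/
def resLieRep (e : κ ↪ ι) : LieRep (gl ι) ⥤ LieRep (gl κ) where
  obj M := ⟨invariants e M.carrier⟩
  map f := invariantsMap e f

lemma isPolynomial_res (e : κ ↪ ι) (M : LieRep (gl ι)) (hM : IsPolynomial ι M) :
    IsPolynomial κ ((resLieRep e).obj M) := by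
  obtain ⟨J, _, d, i, p, h⟩ := hM.exists_sum
  have hinv : ∀ (m : invariants e M.carrier) (j : J), ∀ B ∈ glPerp e, ⁅B, i j m.1⁆ = 0 := by
    intro m j B hB
    rw [← LieModuleHom.map_lie, m.2 B hB, map_zero]
  let i' : ∀ j, invariants e M.carrier →ₗ⁅ℂ, gl κ⁆ TPow κ (d j) := fun j =>
    { toFun := fun m => tproj e (d j) (i j m.1)
      map_add' := fun m m' => by rw [Submodule.coe_add, map_add, map_add]
      map_smul' := fun c m => by rw [Submodule.coe_smul, map_smul, map_smul]; rfl
      map_lie' := fun {A m} => by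
        change tproj e (d j) (i j ⁅glIncl e A, m.1⁆) = ⁅A, tproj e (d j) (i j m.1)⁆
        rw [LieModuleHom.map_lie, tproj_lie] }
  let p' : ∀ j, TPow κ (d j) →ₗ⁅ℂ, gl κ⁆ invariants e M.carrier := fun j =>
    { toFun := fun t => ⟨p j (tincl e (d j) t), fun B hB => by
        rw [← LieModuleHom.map_lie, glPerp_tincl e hB, map_zero]⟩
      map_add' := fun t t' => Subtype.ext (by simp)
      map_smul' := fun c t => Subtype.ext (by simp)
      map_lie' := fun {A t} => Subtype.ext (by
        change p j (tincl e (d j) ⁅A, t⁆) = ⁅glIncl e A, p j (tincl e (d j) t)⁆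
        rw [tincl_lie, LieModuleHom.map_lie]) }
  refine isPolynomial_of_sum _ d i' p' fun m => Subtype.ext ?_
  refine (map_sum (invariants e M.carrier).subtype (fun j => p' j (i' j m)) Finset.univ).trans ?_
  refine (Finset.sum_congr rfl fun j _ => ?_).trans (h m.1)
  change p j (tincl e (d j) (tproj e (d j) (i j m.1))) = _
  rw [tincl_tproj e _ (hinv m j)]

/-- The functor `(·)^{𝔤𝔩_κ^⊥} : Rep(𝔤𝔩_ι)_poly ⥤ Rep(𝔤𝔩_κ)_poly`. -/
def resPoly (e : κ ↪ ι) : RepPoly ι ⥤ RepPoly κ :=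
  (IsPolynomial κ).lift ((IsPolynomial ι).ι ⋙ resLieRep e) fun M => isPolynomial_res e M.obj M.property

/-! ### Schur–Weyl functors -/

/-- The category `Rep(S_d)` of finite-dimensional complex representations of `S_d`. -/
abbrev RepSym (d : ℕ) : Type 1 := FDRep ℂ (Equiv.Perm (Fin d))

/-- The families `(X_d)_d` with `X_d = 0` for all but finitely many `d`. -/
def FinitelySupported : ObjectProperty (∀ d, RepSym d) := fun X => {d | ¬ IsZero (X d)}.Finite

/-- The category `⨁_d Rep(S_d)`: finitely supported families of representations, and families of
morphisms between them. -/
abbrev SumRepSym : Type 1 := FinitelySupported.FullSubcategory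

/-- The underlying intertwining map of a morphism of representations. -/
def toIntertwining {X Y : RepSym d} (f : X ⟶ Y) : Representation.IntertwiningMap X.ρ Y.ρ where
  toLinearMap := f.hom.hom.hom
  isIntertwining' σ := by
    have h := congrArg (fun g => g.hom.hom) (f.comm σ)
    exact h

/-- The action of `S_d` on the representation `(ℂ^N)^{⊗ d}` by permuting the factors. -/
def permRep (ι : Type) (d : ℕ) :
    Representation ℂ (Equiv.Perm (Fin d)) (tensorRep ι d).carrier := permTPow ι d

lemma permRep_lie (σ : Equiv.Perm (Fin d)) (A : gl ι) (t : (tensorRep ι d).carrier) :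
    ⁅A, permRep ι d σ t⁆ = permRep ι d σ ⁅A, t⁆ :=
  permTPow_tensorDeriv σ A.1 t

/-- The space `Hom_{S_d}(X, (ℂ^N)^{⊗ d})`. -/
abbrev SWSpace (ι : Type) (X : RepSym d) : Type := Representation.IntertwiningMap X.ρ (permRep ι d)

/-- `𝔤𝔩_N` acts on `Hom_{S_d}(X, (ℂ^N)^{⊗ d})` through its action on `(ℂ^N)^{⊗ d}`. -/
instance (X : RepSym d) : LieRingModule (gl ι) (SWSpace ι X) where
  bracket A f := ⟨LieModule.toEnd ℂ (gl ι) (tensorRep ι d).carrier A ∘ₗ f.toLinearMap,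
    fun σ => LinearMap.ext fun x => by
      change ⁅A, f (X.ρ σ x)⁆ = permRep ι d σ ⁅A, f x⁆
      rw [f.isIntertwining, permRep_lie]⟩
  add_lie A B f := Representation.IntertwiningMap.ext <| LinearMap.ext fun x => add_lie A B (f x)
  lie_add A f g := Representation.IntertwiningMap.ext <| LinearMap.ext fun x => lie_add A (f x) (g x)
  leibniz_lie A B f :=
    Representation.IntertwiningMap.ext <| LinearMap.ext fun x => leibniz_lie A B (f x)

lemma lie_swSpace_apply (X : RepSym d) (A : gl ι) (f : SWSpace ι X) (x : X) : ⁅A, f⁆ x = ⁅A, f x⁆ := rfl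

instance (X : RepSym d) : LieModule ℂ (gl ι) (SWSpace ι X) where
  smul_lie c A f := Representation.IntertwiningMap.ext <| LinearMap.ext fun x => smul_lie c A (f x)
  lie_smul c A f := Representation.IntertwiningMap.ext <| LinearMap.ext fun x => lie_smul c A (f x)

/-- The contravariant functor `Hom_{S_d}(·, (ℂ^N)^{⊗ d})` from `Rep(S_d)` to representations of
`𝔤𝔩_N`. -/
def swDegree (ι : Type) (d : ℕ) : (RepSym d)ᵒᵖ ⥤ LieRep (gl ι) where
  obj X := ⟨SWSpace ι X.unop⟩
  map {X Y} φ :=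
    { toFun := fun f => f.comp (toIntertwining φ.unop)
      map_add' := fun f g => rfl
      map_smul' := fun c f => rfl
      map_lie' := rfl }

/-- The direct sum of a sequence of representations. -/
def sumLieRep (L : Type) [LieRing L] [LieAlgebra ℂ L] : (∀ _ : ℕ, LieRep L) ⥤ LieRep L where
  obj M := ⟨⨁ d, (M d).carrier⟩
  map {M N} f :=
    { DirectSum.lmap (fun d => (show (M d).carrier →ₗ⁅ℂ, L⁆ (N d).carrier from f d).toLinearMap) with
      map_lie' := fun {A m} => by
        ext d
        exact LieModuleHom.map_lie (show (M d).carrier →ₗ⁅ℂ, L⁆ (N d).carrier from f d) A (m d) }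
  map_id M := LieModuleHom.ext fun m => DFinsupp.ext fun d => rfl
  map_comp f g := LieModuleHom.ext fun m => DFinsupp.ext fun d => rfl

/-- The contravariant functor `(X_d)_d ↦ ⨁_d Hom_{S_d}(X_d, (ℂ^N)^{⊗ d})`. -/
def swLieRep (ι : Type) : SumRepSymᵒᵖ ⥤ LieRep (gl ι) where
  obj X := (sumLieRep (gl ι)).obj fun d => (swDegree ι d).obj (Opposite.op (X.unop.obj d))
  map {X Y} f := (sumLieRep (gl ι)).map (X := fun d => (swDegree ι d).obj (Opposite.op (X.unop.obj d)))
    (Y := fun d => (swDegree ι d).obj (Opposite.op (Y.unop.obj d)))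
    fun d => (swDegree ι d).map (Quiver.Hom.op (f.unop.hom d))
  map_id X := by
    refine LieModuleHom.ext fun m => DFinsupp.ext fun d => ?_
    rfl
  map_comp f g := by
    refine LieModuleHom.ext fun m => DFinsupp.ext fun d => ?_
    rfl

section SWPolynomial

variable (X : RepSym d)

/-- Averaging a linear map over `S_d`. -/
def average (g : X →ₗ[ℂ] (tensorRep ι d).carrier) : SWSpace ι X where
  toLinearMap := (Fintype.card (Equiv.Perm (Fin d)) : ℂ)⁻¹ •
    ∑ σ : Equiv.Perm (Fin d), permRep ι d σ ∘ₗ g ∘ₗ X.ρ σ⁻¹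
  isIntertwining' τ := by
    rw [LinearMap.smul_comp, LinearMap.comp_smul]
    congr 1
    refine LinearMap.ext fun x => ?_
    rw [LinearMap.comp_apply, LinearMap.comp_apply, LinearMap.sum_apply, LinearMap.sum_apply, map_sum]
    refine Fintype.sum_equiv (Equiv.mulLeft τ⁻¹) _ _ fun σ => ?_
    change permRep ι d σ (g (X.ρ σ⁻¹ (X.ρ τ x))) =
      permRep ι d τ (permRep ι d (τ⁻¹ * σ) (g (X.ρ (τ⁻¹ * σ)⁻¹ x)))
    rw [← Module.End.mul_apply, ← Module.End.mul_apply, ← map_mul, ← map_mul, mul_inv_rev, inv_inv,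
      mul_inv_cancel_left]

lemma average_apply (g : X →ₗ[ℂ] (tensorRep ι d).carrier) (x : X) :
    average X g x = (Fintype.card (Equiv.Perm (Fin d)) : ℂ)⁻¹ •
      ∑ σ : Equiv.Perm (Fin d), permRep ι d σ (g (X.ρ σ⁻¹ x)) := by
  change ((Fintype.card (Equiv.Perm (Fin d)) : ℂ)⁻¹ •
    ∑ σ : Equiv.Perm (Fin d), permRep ι d σ ∘ₗ g ∘ₗ X.ρ σ⁻¹) x = _
  rw [LinearMap.smul_apply, LinearMap.sum_apply]
  rfl

lemma average_self (f : SWSpace ι X) : average X f.toLinearMap = f := by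
  refine Representation.IntertwiningMap.ext (LinearMap.ext fun x => ?_)
  change average X f.toLinearMap x = f x
  have h : ∀ σ : Equiv.Perm (Fin d), permRep ι d σ (f.toLinearMap (X.ρ σ⁻¹ x)) = f x := fun σ => by
    change permRep ι d σ (f (X.ρ σ⁻¹ x)) = f x
    rw [f.isIntertwining, ← Module.End.mul_apply, ← map_mul, mul_inv_cancel, map_one,
      Module.End.one_apply]
  rw [average_apply, Finset.sum_congr rfl fun σ _ => h σ, Finset.sum_const, Finset.card_univ,
    ← Nat.cast_smul_eq_nsmul ℂ, smul_smul, inv_mul_cancel₀, one_smul]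
  exact Nat.cast_ne_zero.mpr Fintype.card_ne_zero

/-- Evaluation at a vector. -/
def evalAt (x : X) : SWSpace ι X →ₗ⁅ℂ, gl ι⁆ (tensorRep ι d).carrier where
  toFun f := f x
  map_add' _ _ := rfl
  map_smul' _ _ := rfl
  map_lie' := rfl

/-- The average of the rank one map attached to a linear form. -/
def averageForm (l : X →ₗ[ℂ] ℂ) : (tensorRep ι d).carrier →ₗ⁅ℂ, gl ι⁆ SWSpace ι X where
  toFun t := average X (l.smulRight t)
  map_add' s t := by
    refine Representation.IntertwiningMap.ext (LinearMap.ext fun x => ?_)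
    change average X _ x = average X _ x + average X _ x
    simp only [average_apply, LinearMap.smulRight_apply, smul_add, map_add, Finset.sum_add_distrib]
  map_smul' c t := by
    refine Representation.IntertwiningMap.ext (LinearMap.ext fun x => ?_)
    change average X _ x = c • average X _ x
    simp only [average_apply, LinearMap.smulRight_apply, map_smul, Finset.smul_sum, smul_smul]
    refine Finset.sum_congr rfl fun σ _ => ?_
    congr 1
    ring
  map_lie' {A t} := by
    refine Representation.IntertwiningMap.ext (LinearMap.ext fun x => ?_)
    change average X _ x = ⁅A, average X _ x⁆
    simp only [average_apply, LinearMap.smulRight_apply, map_smul, lie_smul, lie_sum, permRep_lie]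

lemma sum_averageForm (f : SWSpace ι X) :
    ∑ k, averageForm X ((Module.finBasis ℂ X).coord k) (evalAt X (Module.finBasis ℂ X k) f) = f := by
  conv_rhs => rw [← average_self X f]
  refine Representation.IntertwiningMap.ext (LinearMap.ext fun x => ?_)
  rw [Representation.IntertwiningMap.toLinearMap_sum, LinearMap.sum_apply]
  change ∑ k, average X (((Module.finBasis ℂ X).coord k).smulRight (f (Module.finBasis ℂ X k))) x =
    average X f.toLinearMap x
  simp only [average_apply]
  rw [← Finset.smul_sum, Finset.sum_comm]
  congr 1
  refine Finset.sum_congr rfl fun σ _ => ?_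
  rw [← map_sum]
  congr 1
  conv_rhs => rw [← (Module.finBasis ℂ X).sum_repr (X.ρ σ⁻¹ x), map_sum]
  refine Finset.sum_congr rfl fun k _ => ?_
  rw [map_smul]
  rfl

lemma swSpace_eq_zero (hX : IsZero X) (f : SWSpace ι X) : f = 0 := by
  refine Representation.IntertwiningMap.ext (LinearMap.ext fun x => ?_)
  have h : toIntertwining (𝟙 X) = toIntertwining (0 : X ⟶ X) :=
    congrArg toIntertwining (hX.eq_of_src _ _)
  have hx : x = 0 := congrArg (fun g : Representation.IntertwiningMap X.ρ X.ρ => g x) h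
  rw [hx, map_zero, map_zero]

end SWPolynomial

lemma isPolynomial_sw (ι : Type) (X : SumRepSymᵒᵖ) : IsPolynomial ι ((swLieRep ι).obj X) := by
  classical
  let Y : ∀ d, RepSym d := X.unop.obj
  let s : Finset ℕ := Set.Finite.toFinset X.unop.property
  let J : Type := Σ d : s, Fin (Module.finrank ℂ (Y d.1))
  refine isPolynomial_of_sum_aux _ (J := J) (fun j => j.1.1)
    (fun j => (evalAt (Y j.1.1) (Module.finBasis ℂ (Y j.1.1) j.2)).comp
      (DirectSum.lieModuleComponent ℂ ℕ (gl ι)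
        (fun d => ((swDegree ι d).obj (Opposite.op (Y d))).carrier) j.1.1))
    (fun j => (DirectSum.lieModuleOf ℂ ℕ (gl ι)
        (fun d => ((swDegree ι d).obj (Opposite.op (Y d))).carrier) j.1.1).comp
      (averageForm (Y j.1.1) ((Module.finBasis ℂ (Y j.1.1)).coord j.2))) fun m => ?_
  let m' : ⨁ d, ((swDegree ι d).obj (Opposite.op (Y d))).carrier := m
  have hm : ∀ d, d ∉ s → m' d = 0 := fun d hd => by
    have hz : IsZero (Y d) := by
      by_contra h
      exact hd ((Set.Finite.mem_toFinset _).mpr h)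
    exact swSpace_eq_zero (Y d) hz _
  let o := fun d => DirectSum.lieModuleOf ℂ ℕ (gl ι)
    (fun d => ((swDegree ι d).obj (Opposite.op (Y d))).carrier) d
  change ∑ j : J, o j.1.1 (averageForm (Y j.1.1) ((Module.finBasis ℂ (Y j.1.1)).coord j.2)
    (evalAt (Y j.1.1) (Module.finBasis ℂ (Y j.1.1) j.2) (m' j.1.1))) = m'
  rw [Fintype.sum_sigma]
  have h1 : ∀ d : s, ∑ k, o d.1 (averageForm (Y d.1) ((Module.finBasis ℂ (Y d.1)).coord k)
      (evalAt (Y d.1) (Module.finBasis ℂ (Y d.1) k) (m' d.1))) = o d.1 (m' d.1) := fun d =>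
    (map_sum (o d.1) _ _).symm.trans (congrArg (o d.1) (sum_averageForm (Y d.1) (m' d.1)))
  refine (Finset.sum_congr rfl fun d _ => h1 d).trans ?_
  rw [Finset.sum_coe_sort s fun d => o d (m' d)]
  refine Eq.trans (Eq.symm ?_) (DirectSum.sum_support_of m')
  refine Finset.sum_subset (fun d hd => ?_) fun d _ hd => ?_
  · by_contra h
    exact (DFinsupp.mem_support_iff.mp hd) (hm d h)
  · rw [DFinsupp.notMem_support_iff.mp hd]
    exact map_zero (o d)

/-- The contravariant Schur–Weyl functor
`SW_{ℂ^N} = ⨁_d Hom_{S_d}(·, (ℂ^N)^{⊗ d}) : ⨁_d Rep(S_d) → Rep(𝔤𝔩_N)_poly`. -/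
def SW (ι : Type) : SumRepSymᵒᵖ ⥤ RepPoly ι :=
  (IsPolynomial ι).lift (swLieRep ι) (isPolynomial_sw ι)

/-- The functor `SW_∞`. -/
abbrev SWInfty : SumRepSymᵒᵖ ⥤ RepPoly ℕ := SW ℕ

/-! ### Compatibility of the Schur–Weyl functors with restriction -/

section Compat

variable (e : κ ↪ ι)

/-- Composition with the projection `(ℂ^ι)^{⊗ d} → (ℂ^κ)^{⊗ d}`. -/
def swProj (X : RepSym d) : SWSpace ι X →ₗ[ℂ] SWSpace κ X where
  toFun f := Representation.IntertwiningMap.comp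
    (⟨tproj e d, fun σ => LinearMap.ext fun t => permTPow_tensorMap σ (proj e) t⟩ :
      Representation.IntertwiningMap (permRep ι d) (permRep κ d)) f
  map_add' f g := Representation.IntertwiningMap.ext <| LinearMap.ext fun x =>
    map_add (tproj e d) (f x) (g x)
  map_smul' c f := Representation.IntertwiningMap.ext <| LinearMap.ext fun x =>
    map_smul (tproj e d) c (f x)

/-- Composition with the inclusion `(ℂ^κ)^{⊗ d} → (ℂ^ι)^{⊗ d}`. -/
def swIncl (X : RepSym d) : SWSpace κ X →ₗ[ℂ] SWSpace ι X where
  toFun f := Representation.IntertwiningMap.comp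
    (⟨tincl e d, fun σ => LinearMap.ext fun t => permTPow_tensorMap σ (incl e) t⟩ :
      Representation.IntertwiningMap (permRep κ d) (permRep ι d)) f
  map_add' f g := Representation.IntertwiningMap.ext <| LinearMap.ext fun x =>
    map_add (tincl e d) (f x) (g x)
  map_smul' c f := Representation.IntertwiningMap.ext <| LinearMap.ext fun x =>
    map_smul (tincl e d) c (f x)

lemma swProj_lie (X : RepSym d) (A : gl κ) (f : SWSpace ι X) :
    swProj e X ⁅glIncl e A, f⁆ = ⁅A, swProj e X f⁆ :=
  Representation.IntertwiningMap.ext <| LinearMap.ext fun x => tproj_lie e A (f x)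

lemma swIncl_lie (X : RepSym d) (A : gl κ) (f : SWSpace κ X) :
    swIncl e X ⁅A, f⁆ = ⁅glIncl e A, swIncl e X f⁆ :=
  Representation.IntertwiningMap.ext <| LinearMap.ext fun x => tincl_lie e A (f x)

lemma glPerp_swIncl (X : RepSym d) {B : gl ι} (hB : B ∈ glPerp e) (f : SWSpace κ X) :
    ⁅B, swIncl e X f⁆ = 0 :=
  Representation.IntertwiningMap.ext <| LinearMap.ext fun x => glPerp_tincl e hB (f x)

lemma swProj_swIncl (X : RepSym d) (f : SWSpace κ X) : swProj e X (swIncl e X f) = f :=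
  Representation.IntertwiningMap.ext <| LinearMap.ext fun x => tproj_tincl e (f x)

lemma swIncl_swProj (X : RepSym d) (f : SWSpace ι X) (hf : ∀ B ∈ glPerp e, ⁅B, f⁆ = 0) :
    swIncl e X (swProj e X f) = f :=
  Representation.IntertwiningMap.ext <| LinearMap.ext fun x => tincl_tproj e (f x) fun B hB =>
    congrArg (fun g : SWSpace ι X => g x) (hf B hB)

/-- The space underlying `SW_{ℂ^N}(X)`. -/
abbrev SWCarrier (ι : Type) (X : SumRepSymᵒᵖ) : Type :=
  ⨁ d, ((swDegree ι d).obj (Opposite.op (X.unop.obj d))).carrier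

/-- The isomorphism `SW_{ℂ^ι}(X)^{𝔤𝔩_κ^⊥} → SW_{ℂ^κ}(X)` given by the coordinate projection; its inverse
is given by the inclusion `ℂ^κ ⊆ ℂ^ι`. -/
def swResHom (X : SumRepSymᵒᵖ) : invariants e (SWCarrier ι X) →ₗ⁅ℂ, gl κ⁆ SWCarrier κ X where
  toFun m := DirectSum.lmap (fun d => swProj e (X.unop.obj d)) m.1
  map_add' m m' := map_add _ m.1 m'.1
  map_smul' c m := map_smul _ c m.1
  map_lie' {A m} := DFinsupp.ext fun d => swProj_lie e (X.unop.obj d) A (m.1 d)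

/-- The inverse of `swResHom`. -/
def swResInv (X : SumRepSymᵒᵖ) : SWCarrier κ X →ₗ⁅ℂ, gl κ⁆ invariants e (SWCarrier ι X) where
  toFun m := ⟨DirectSum.lmap (fun d => swIncl e (X.unop.obj d)) m, fun _ hB =>
    DFinsupp.ext fun d => glPerp_swIncl e (X.unop.obj d) hB (m d)⟩
  map_add' m m' := Subtype.ext (map_add _ m m')
  map_smul' c m := Subtype.ext (map_smul _ c m)
  map_lie' {A m} := Subtype.ext (DFinsupp.ext fun d => swIncl_lie e (X.unop.obj d) A (m d))

lemma swResInv_swResHom (X : SumRepSymᵒᵖ) (m : invariants e (SWCarrier ι X)) :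
    swResInv e X (swResHom e X m) = m :=
  Subtype.ext <| DFinsupp.ext fun d => swIncl_swProj e (X.unop.obj d) (m.1 d) fun B hB =>
    congrArg (fun g : SWCarrier ι X => g d) (m.2 B hB)

lemma swResHom_swResInv (X : SumRepSymᵒᵖ) (m : SWCarrier κ X) :
    swResHom e X (swResInv e X m) = m :=
  DFinsupp.ext fun d => swProj_swIncl e (X.unop.obj d) (m d)

/-- The natural isomorphism `(·)^{𝔤𝔩_κ^⊥} ∘ SW_{ℂ^ι} ≅ SW_{ℂ^κ}`. -/
def swResIso : SW ι ⋙ resPoly e ≅ SW κ :=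
  NatIso.ofComponents
    (fun X => ObjectProperty.isoMk _
      { hom := swResHom e X
        inv := swResInv e X
        hom_inv_id := LieModuleHom.ext (swResInv_swResHom e X)
        inv_hom_id := LieModuleHom.ext (swResHom_swResInv e X) })
    (fun _ => ObjectProperty.hom_ext _ (LieModuleHom.ext fun _ => DFinsupp.ext fun _ => rfl))

end Compat

/-! ### Inverse limits and restricted inverse limits of categories -/

section InverseLimit

universe v u

variable (C : ℕ → Type u) [∀ n, Category.{v} (C n)] (F : ∀ n, C (n + 1) ⥤ C n)

/-- Objects of the inverse limit of the system `⋯ ⥤ C 2 ⥤ C 1 ⥤ C 0`: sequences of objects `X_n` with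
isomorphisms `F(X_{n+1}) ≅ X_n`. -/
structure InvLim where
  obj : ∀ n, C n
  iso : ∀ n, (F n).obj (obj (n + 1)) ≅ obj n

variable {C F}

/-- Morphisms of the inverse limit: sequences of morphisms compatible with the isomorphisms. -/
@[ext]
structure InvLim.Hom (X Y : InvLim C F) where
  app : ∀ n, X.obj n ⟶ Y.obj n
  comm : ∀ n, (F n).map (app (n + 1)) ≫ (Y.iso n).hom = (X.iso n).hom ≫ app n

instance : Category (InvLim C F) where
  Hom X Y := InvLim.Hom X Y
  id X := ⟨fun n => 𝟙 _, fun n => by simp⟩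
  comp f g := ⟨fun n => f.app n ≫ g.app n, fun n => by
    rw [Functor.map_comp, Category.assoc, g.comm, ← Category.assoc, f.comm, Category.assoc]⟩

@[ext]
lemma InvLim.hom_ext {X Y : InvLim C F} {f g : X ⟶ Y} (h : ∀ n, f.app n = g.app n) : f = g :=
  InvLim.Hom.ext (funext h)

/-- The (Jordan–Hölder) length of an object: the supremum of the lengths of chains of subobjects. -/
def objectLength {D : Type u} [Category.{v} D] (X : D) : ℕ∞ := Order.height (⊤ : Subobject X)

variable (C F)

/-- The objects `(X_n)_n` of the inverse limit such that the lengths of the `X_n` are bounded. -/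
def BoundedLength : ObjectProperty (InvLim C F) := fun X => ∃ l : ℕ, ∀ n, objectLength (X.obj n) ≤ l

/-- The restricted inverse limit. -/
abbrev RestrInvLim : Type (max u v) := (BoundedLength C F).FullSubcategory

variable {C F}

/-- The functor to the inverse limit induced by compatible functors to the terms of the system. -/
def InvLim.lift {D : Type*} [Category* D] (G : ∀ n, D ⥤ C n) (α : ∀ n, G (n + 1) ⋙ F n ≅ G n) :
    D ⥤ InvLim C F where
  obj X := ⟨fun n => (G n).obj X, fun n => (α n).app X⟩
  map f := ⟨fun n => (G n).map f, fun n => (α n).hom.naturality f⟩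
  map_id X := InvLim.hom_ext fun n => (G n).map_id X
  map_comp f g := InvLim.hom_ext fun n => (G n).map_comp f g

variable [∀ n, Preadditive (C n)] [∀ n, (F n).Additive]

instance (X Y : InvLim C F) : Zero (X ⟶ Y) := ⟨⟨fun _ => 0, fun n => by simp⟩⟩

instance (X Y : InvLim C F) : Add (X ⟶ Y) :=
  ⟨fun f g => ⟨fun n => f.app n + g.app n, fun n => by
    rw [Functor.map_add, Preadditive.add_comp, Preadditive.comp_add, f.comm, g.comm]⟩⟩

instance (X Y : InvLim C F) : Neg (X ⟶ Y) :=
  ⟨fun f => ⟨fun n => -f.app n, fun n => by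
    rw [Functor.map_neg, Preadditive.neg_comp, Preadditive.comp_neg, f.comm]⟩⟩

instance : Preadditive (InvLim C F) where
  homGroup X Y :=
    { add_assoc := fun f g h => InvLim.hom_ext fun n => add_assoc (f.app n) (g.app n) (h.app n)
      zero_add := fun f => InvLim.hom_ext fun n => zero_add (f.app n)
      add_zero := fun f => InvLim.hom_ext fun n => add_zero (f.app n)
      nsmul := nsmulRec
      zsmul := zsmulRec
      neg_add_cancel := fun f => InvLim.hom_ext fun n => neg_add_cancel (f.app n)
      add_comm := fun f g => InvLim.hom_ext fun n => add_comm (f.app n) (g.app n) }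
  add_comp _ _ _ f f' g := InvLim.hom_ext fun n => Preadditive.add_comp _ _ _ (f.app n) (f'.app n) (g.app n)
  comp_add _ _ _ f g g' := InvLim.hom_ext fun n => Preadditive.comp_add _ _ _ (f.app n) (g.app n) (g'.app n)

variable [∀ n, Linear ℂ (C n)] [∀ n, (F n).Linear ℂ]

instance (X Y : InvLim C F) : SMul ℂ (X ⟶ Y) :=
  ⟨fun c f => ⟨fun n => c • f.app n, fun n => by
    rw [Functor.map_smul, Linear.smul_comp, Linear.comp_smul, f.comm]⟩⟩

instance : Linear ℂ (InvLim C F) where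
  homModule X Y :=
    { one_smul := fun f => InvLim.hom_ext fun n => one_smul ℂ (f.app n)
      mul_smul := fun c c' f => InvLim.hom_ext fun n => mul_smul c c' (f.app n)
      smul_zero := fun c => InvLim.hom_ext fun n => smul_zero (A := X.obj n ⟶ Y.obj n) c
      smul_add := fun c f g => InvLim.hom_ext fun n => smul_add c (f.app n) (g.app n)
      add_smul := fun c c' f => InvLim.hom_ext fun n => add_smul c c' (f.app n)
      zero_smul := fun f => InvLim.hom_ext fun n => zero_smul ℂ (f.app n) }
  smul_comp _ _ _ c f g := InvLim.hom_ext fun n => Linear.smul_comp _ _ _ c (f.app n) (g.app n)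
  comp_smul _ _ _ f c g := InvLim.hom_ext fun n => Linear.comp_smul _ _ _ (f.app n) c (g.app n)

end InverseLimit

/-- Addition of morphisms in a product of preadditive categories is componentwise. -/
instance piPreadditive {I : Type} (C : I → Type 1) [∀ i, Category.{0} (C i)] [∀ i, Preadditive (C i)] :
    Preadditive (∀ i, C i) where
  homGroup X Y := inferInstanceAs (AddCommGroup (∀ i, X i ⟶ Y i))
  add_comp _ _ _ f f' g := funext fun i => Preadditive.add_comp _ _ _ (f i) (f' i) (g i)
  comp_add _ _ _ f g g' := funext fun i => Preadditive.comp_add _ _ _ (f i) (g i) (g' i)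

/-- Scalar multiplication of morphisms in a product of linear categories is componentwise. -/
instance piLinear {I : Type} (C : I → Type 1) [∀ i, Category.{0} (C i)] [∀ i, Preadditive (C i)]
    [∀ i, Linear ℂ (C i)] : Linear ℂ (∀ i, C i) where
  homModule X Y := inferInstanceAs (Module ℂ (∀ i, X i ⟶ Y i))
  smul_comp _ _ _ c f g := funext fun i => Linear.smul_comp _ _ _ c (f i) (g i)
  comp_smul _ _ _ f c g := funext fun i => Linear.comp_smul _ _ _ (f i) c (g i)

/-- A contravariant functor between `ℂ`-linear categories is an anti-equivalence (of `ℂ`-linear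
categories) if it is an equivalence from the opposite category and is additive and `ℂ`-linear on
morphisms. -/
structure IsAntiEquivalence {D E : Type*} [Category* D] [Category* E] [Preadditive D] [Preadditive E]
    [Linear ℂ D] [Linear ℂ E] (G : Dᵒᵖ ⥤ E) : Prop where
  isEquivalence : G.IsEquivalence
  map_add : ∀ {X Y : D} (f g : X ⟶ Y), G.map (f + g).op = G.map f.op + G.map g.op
  map_smul : ∀ {X Y : D} (c : ℂ) (f : X ⟶ Y), G.map (c • f).op = c • G.map f.op

/-- A preadditive category is semisimple if it is abelian and every object is a finite direct sum of
simple objects. -/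
def IsSemisimpleCategory (D : Type*) [Category* D] [P : Preadditive D] : Prop :=
  (∃ A : Abelian D, A.toPreadditive = P) ∧
    ∀ X : D, ∃ (n : ℕ) (S : Fin n → D) (b : Bicone S),
      (∀ i, Simple (S i)) ∧ Nonempty b.IsBilimit ∧ Nonempty (b.pt ≅ X)

/-! ### The system of categories `Rep(𝔤𝔩_n)_poly` -/

/-- The category `Rep(𝔤𝔩_n)_poly` for a natural number `n`. -/
abbrev RepPolyFin (n : ℕ) : Type 1 := RepPoly (Fin n)

/-- The restriction functor `Res_{n, n+1} = (·)^{𝔤𝔩_n^⊥}`. -/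
abbrev Res (n : ℕ) : RepPolyFin (n + 1) ⥤ RepPolyFin n := resPoly Fin.castSuccEmb

instance (e : κ ↪ ι) : (resPoly e).Additive where
  map_add := ObjectProperty.hom_ext _ (LieModuleHom.ext fun _ => rfl)

instance (e : κ ↪ ι) : (resPoly e).Linear ℂ where
  map_smul _ _ := ObjectProperty.hom_ext _ (LieModuleHom.ext fun _ => rfl)

/-- The functor to the inverse limit of the `Rep(𝔤𝔩_n)_poly` induced by the functors `SW_{ℂ^n}` and the
isomorphisms `Res_{n, n+1} ∘ SW_{ℂ^{n+1}} ≅ SW_{ℂ^n}`. -/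
def SWInvLim : SumRepSymᵒᵖ ⥤ InvLim RepPolyFin Res :=
  InvLim.lift (fun n => SW (Fin n)) fun _ => swResIso Fin.castSuccEmb

/-- The restricted inverse limit of the categories `Rep(𝔤𝔩_n)_poly`. -/
abbrev RestrRepPoly : Type 1 := RestrInvLim RepPolyFin Res

end SchurWeyl

end

/-! Everything rests on the equivariant maps between the tensor powers T^d = (ℂ^N)^{⊗ d}. Diagonal
matrices force such maps to preserve weights, so they vanish between different degrees
(`tensorHom_eq_zero`). If N ≥ 3d, a tensor e_w of d distinct basis vectors generates T^d, since
matrix units exchange its factors one at a time (`hom_eq_zero_of_tvec`). An endomorphism of T^d is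
then determined by its value at e_w, which lies in the weight space spanned by the permutations of
e_w. Hence End(T^d) is spanned by S_d (`exists_eq_permHom`), without any appeal to the double
centraliser theorem.

Consequently, for φ : Hom(Y, T^d) → Hom(X, T^d) and x in X, the map f ↦ φ(f)(x) is evaluation at a
unique y in Y. So the Schur–Weyl functor is full and faithful on degrees ≤ D once N ≥ 3D (`sw_full`,
`sw_faithful`). The regular representation exhibits T^d as a summand of an object in the image, and
idempotents lift along a fully faithful functor, so every summand of a finite sum of T^d with d ≤ D
is reached (`sw_essSurj`). For N = ∞ there is no constraint on D.

For the limit, the identity matrix acts on T^d by d, degrees survive from level n to level n + 1,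
and the number of degrees is at most the length. Bounded length therefore bounds the degrees by some
D (`exists_degree_bound`). For n ≥ 3D each M_n comes from some X_n, full faithfulness identifies all
the X_n, and objects and morphisms of the limit are determined by their tails. Conversely, the
length of the image of X at level n is at most Σ dim X_d · d! for large n (`boundedLength_sw`).

Semisimplicity comes from Maschke's theorem in the form that every morphism has a pseudo-inverse.
With split idempotents and finite products this makes the category abelian with split monomorphisms;
induction on dimension decomposes objects into bricks, which are simple. The property is transported
along the two anti-equivalences. -/

noncomputable section

namespace SchurWeyl

attribute [local instance] LieRing.ofAssociativeRing

/-! ### Regular categories and semisimplicity -/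

section Regular

universe v u

/-- A category is (von Neumann) regular if every morphism has a pseudo-inverse. -/
def IsVonNeumannRegular (C : Type u) [Category.{v} C] : Prop :=
  ∀ ⦃X Y : C⦄ (f : X ⟶ Y), ∃ g : Y ⟶ X, f ≫ g ≫ f = f

variable {C : Type u} [Category.{v} C]

lemma IsVonNeumannRegular.exists_retraction (h : IsVonNeumannRegular C) {X Y : C} (f : X ⟶ Y)
    [Mono f] : ∃ g : Y ⟶ X, f ≫ g = 𝟙 X := by
  obtain ⟨g, hg⟩ := h f
  exact ⟨g, by rw [← cancel_mono f, Category.assoc, hg, Category.id_comp]⟩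

lemma IsVonNeumannRegular.exists_section (h : IsVonNeumannRegular C) {X Y : C} (f : X ⟶ Y)
    [Epi f] : ∃ g : Y ⟶ X, g ≫ f = 𝟙 Y := by
  obtain ⟨g, hg⟩ := h f
  exact ⟨g, by rw [← cancel_epi f, hg, Category.comp_id]⟩

variable [Preadditive C]

/-- From `f ≫ g ≫ f = f` the endomorphism `f ≫ g` is idempotent, and the image of the complementary
idempotent is the kernel of `f`. Cokernels arise dually from `g ≫ f`. -/
lemma IsVonNeumannRegular.hasKernels [IsIdempotentComplete C] (h : IsVonNeumannRegular C) :
    HasKernels C where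
  has_limit {X Y} f := by
    obtain ⟨g, hg⟩ := h f
    obtain ⟨K, i, r, hir, hri⟩ := IsIdempotentComplete.idempotents_split X (𝟙 X - f ≫ g)
      (by simp [Preadditive.sub_comp, Preadditive.comp_sub, reassoc_of% hg])
    have hw : i ≫ f = 0 := by
      have : i ≫ (r ≫ i) ≫ f = i ≫ f := by rw [Category.assoc, reassoc_of% hir]
      rw [← this, hri]
      simp [Preadditive.sub_comp, hg]
    have : Mono i := (SplitMono.mk r hir).mono
    exact ⟨⟨KernelFork.ofι i hw, KernelFork.IsLimit.ofι' i hw fun {A} k hk => ⟨k ≫ r, by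
      rw [Category.assoc, hri, Preadditive.comp_sub, reassoc_of% hk, zero_comp, sub_zero,
        Category.comp_id]⟩⟩⟩

lemma IsVonNeumannRegular.hasCokernels [IsIdempotentComplete C] (h : IsVonNeumannRegular C) :
    HasCokernels C where
  has_colimit {X Y} f := by
    obtain ⟨g, hg⟩ := h f
    obtain ⟨K, i, r, hir, hri⟩ := IsIdempotentComplete.idempotents_split Y (𝟙 Y - g ≫ f)
      (by simp [Preadditive.sub_comp, Preadditive.comp_sub, hg])
    have hw : f ≫ r = 0 := by
      have : f ≫ (r ≫ i) ≫ r = f ≫ r := by rw [Category.assoc, hir, Category.comp_id]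
      rw [← this, hri]
      simp [Preadditive.sub_comp, Preadditive.comp_sub, reassoc_of% hg]
    have : Epi r := (SplitEpi.mk i hir).epi
    exact ⟨⟨CokernelCofork.ofπ r hw, CokernelCofork.IsColimit.ofπ' r hw fun {A} k hk => ⟨i ≫ k, by
      rw [← Category.assoc, hri, Preadditive.sub_comp, Category.assoc, hk, comp_zero, sub_zero,
        Category.id_comp]⟩⟩⟩

/-- A regular idempotent complete additive category is abelian. -/
lemma IsVonNeumannRegular.exists_abelian [IsIdempotentComplete C] [HasFiniteProducts C]
    (h : IsVonNeumannRegular C) : ∃ A : Abelian C, A.toPreadditive = ‹Preadditive C› := by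
  have := h.hasKernels
  have := h.hasCokernels
  -- A monomorphism `f` with retraction `g` is the kernel of `𝟙 Y - g ≫ f`; epimorphisms are treated
  -- dually.
  have : IsNormalMonoCategory C := ⟨fun {X Y} f hf => by
    obtain ⟨g, hg⟩ := h.exists_retraction f
    have hw : f ≫ (𝟙 Y - g ≫ f) = 0 := by
      rw [Preadditive.comp_sub, reassoc_of% hg, Category.comp_id, sub_self]
    exact ⟨⟨Y, 𝟙 Y - g ≫ f, hw, KernelFork.IsLimit.ofι' f hw fun {A} k hk => ⟨k ≫ g, by
      rw [Preadditive.comp_sub, Category.comp_id, sub_eq_zero] at hk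
      rw [Category.assoc, ← hk]⟩⟩⟩⟩
  have : IsNormalEpiCategory C := ⟨fun {X Y} f hf => by
    obtain ⟨g, hg⟩ := h.exists_section f
    have hw : (𝟙 X - f ≫ g) ≫ f = 0 := by
      rw [Preadditive.sub_comp, Category.assoc, hg, Category.comp_id, Category.id_comp, sub_self]
    exact ⟨⟨X, 𝟙 X - f ≫ g, hw, CokernelCofork.IsColimit.ofπ' f hw fun {A} k hk => ⟨g ≫ k, by
      rw [Preadditive.sub_comp, Category.id_comp, sub_eq_zero] at hk
      rw [← Category.assoc, ← hk]⟩⟩⟩⟩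
  exact ⟨{}, rfl⟩

/-- A nonzero object without nontrivial idempotent endomorphisms. -/
def IsBrick (S : C) : Prop := 𝟙 S ≠ 0 ∧ ∀ e : S ⟶ S, e ≫ e = e → e = 0 ∨ e = 𝟙 S

/-- A subobject of `S` splits, hence yields an idempotent of `S`; it is 0 or 1, so the subobject is
zero or all of `S`. -/
lemma IsBrick.simple (h : IsVonNeumannRegular C) {S : C} (hS : IsBrick S) : Simple S where
  mono_isIso_iff_nonzero {Y} f hf := by
    obtain ⟨g, hg⟩ := h.exists_retraction f
    constructor
    · rintro hi rfl
      rw [zero_comp] at hg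
      exact hS.1 (by rw [← IsIso.inv_hom_id (0 : Y ⟶ S), comp_zero])
    · intro hne
      rcases hS.2 (g ≫ f) (by rw [Category.assoc, reassoc_of% hg]) with h0 | h1
      · refine absurd ?_ hne
        rw [← Category.id_comp f, ← hg, Category.assoc, h0, comp_zero]
      · exact ⟨g, hg, h1⟩

/-- A finite decomposition of the identity of `X` through bricks. -/
def HasBrickDecomposition (X : C) : Prop :=
  ∃ (J : Type) (_ : Fintype J) (S : J → C) (i : ∀ j, S j ⟶ X) (p : ∀ j, X ⟶ S j),
    (∀ j, IsBrick (S j)) ∧ (∀ j, i j ≫ p j = 𝟙 _) ∧ (∀ j k, j ≠ k → i j ≫ p k = 0) ∧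
      ∑ j, p j ≫ i j = 𝟙 X

/-- If splitting off a nontrivial idempotent decreases the natural number `size`, then every object is
a finite direct sum of bricks. -/
lemma hasBrickDecomposition_of_size [IsIdempotentComplete C] (size : C → ℕ)
    (hsize : ∀ ⦃A X : C⦄ (i : A ⟶ X) (r : X ⟶ A), i ≫ r = 𝟙 A → r ≫ i ≠ 𝟙 X → size A < size X)
    (X : C) : HasBrickDecomposition X := by
  induction hn : size X using Nat.strong_induction_on generalizing X with
  | _ n ih =>
    by_cases h0 : 𝟙 X = 0
    · exact ⟨Empty, inferInstance, Empty.elim, fun j => j.elim, fun j => j.elim, fun j => j.elim,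
        fun j => j.elim, fun j => j.elim, by simp [h0]⟩
    by_cases hB : IsBrick X
    · exact ⟨Unit, inferInstance, fun _ => X, fun _ => 𝟙 X, fun _ => 𝟙 X, fun _ => hB, by simp,
        fun j k hjk => absurd (Subsingleton.elim j k) hjk, by simp⟩
    have : ∃ e : X ⟶ X, e ≫ e = e ∧ e ≠ 0 ∧ e ≠ 𝟙 X := by
      by_contra hc
      push Not at hc
      refine hB ⟨h0, fun e he => ?_⟩
      by_cases h : e = 0
      · exact Or.inl h
      · exact Or.inr (hc e he h)
    obtain ⟨e, he, he0, he1⟩ := this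
    -- Both complementary summands are smaller than `X`: the first because `e ≠ 𝟙 X`, the second
    -- because `e ≠ 0`. The induction hypothesis applies to each.
    obtain ⟨A, i, r, hir, hri⟩ := IsIdempotentComplete.idempotents_split X e he
    obtain ⟨B, i', r', hir', hri'⟩ := IsIdempotentComplete.idempotents_split X (𝟙 X - e)
      (by simp [Preadditive.sub_comp, Preadditive.comp_sub, he])
    have hA : size A < n := hn ▸ hsize i r hir (by rwa [hri])
    have hB : size B < n := hn ▸ hsize i' r' hir' (by
      rw [hri']
      intro h
      exact he0 (by simpa using h))
    have hz : i ≫ r' = 0 := by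
      have : i ≫ (r ≫ i) ≫ (r' ≫ i') ≫ r' = i ≫ r' := by
        rw [Category.assoc, Category.assoc, reassoc_of% hir, hir', Category.comp_id]
      rw [← this, hri, hri', ← Category.assoc e]
      simp [Preadditive.comp_sub, he]
    have hz' : i' ≫ r = 0 := by
      have : i' ≫ (r' ≫ i') ≫ (r ≫ i) ≫ r = i' ≫ r := by
        rw [Category.assoc, Category.assoc, reassoc_of% hir', hir, Category.comp_id]
      rw [← this, hri, hri', ← Category.assoc _ e]
      simp [Preadditive.sub_comp, he]
    obtain ⟨J, _, S, a, p, hS, h1, h2, h3⟩ := ih _ hA A rfl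
    obtain ⟨J', _, S', a', p', hS', h1', h2', h3'⟩ := ih _ hB B rfl
    refine ⟨J ⊕ J', inferInstance, Sum.elim S S',
      fun j => Sum.rec (motive := fun j => Sum.elim S S' j ⟶ X) (fun j => a j ≫ i)
        (fun j => a' j ≫ i') j,
      fun j => Sum.rec (motive := fun j => X ⟶ Sum.elim S S' j) (fun j => r ≫ p j)
        (fun j => r' ≫ p' j) j, ?_, ?_, ?_, ?_⟩
    · rintro (j | j)
      exacts [hS j, hS' j]
    · rintro (j | j)
      · change (a j ≫ i) ≫ r ≫ p j = 𝟙 (S j)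
        rw [Category.assoc, reassoc_of% hir, h1]
      · change (a' j ≫ i') ≫ r' ≫ p' j = 𝟙 (S' j)
        rw [Category.assoc, reassoc_of% hir', h1']
    · rintro (j | j) (k | k) hjk
      · change (a j ≫ i) ≫ r ≫ p k = 0
        rw [Category.assoc, reassoc_of% hir, h2 j k fun h => hjk (h ▸ rfl)]
      · change (a j ≫ i) ≫ r' ≫ p' k = 0
        rw [Category.assoc, reassoc_of% hz, zero_comp, comp_zero]
      · change (a' j ≫ i') ≫ r ≫ p k = 0
        rw [Category.assoc, reassoc_of% hz', zero_comp, comp_zero]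
      · change (a' j ≫ i') ≫ r' ≫ p' k = 0
        rw [Category.assoc, reassoc_of% hir', h2' j k fun h => hjk (h ▸ rfl)]
    · have e1 : ∑ j, (r ≫ p j) ≫ a j ≫ i = e := by
        simp only [Category.assoc, ← Preadditive.comp_sum]
        simp only [← Category.assoc (p _), ← Preadditive.sum_comp]
        rw [h3, Category.id_comp, hri]
      have e2 : ∑ j, (r' ≫ p' j) ≫ a' j ≫ i' = 𝟙 X - e := by
        simp only [Category.assoc, ← Preadditive.comp_sum]
        simp only [← Category.assoc (p' _), ← Preadditive.sum_comp]
        rw [h3', Category.id_comp, hri']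
      rw [Fintype.sum_sum_type]
      exact (congrArg₂ (· + ·) e1 e2).trans (add_sub_cancel _ _)

lemma isSemisimpleCategory_of_bricks (h : IsVonNeumannRegular C)
    (hA : ∃ A : Abelian C, A.toPreadditive = ‹Preadditive C›)
    (hd : ∀ X : C, HasBrickDecomposition X) : IsSemisimpleCategory C := by
  classical
  refine ⟨hA, fun X => ?_⟩
  obtain ⟨J, _, S, i, p, hS, h1, h2, h3⟩ := hd X
  let ε := (Fintype.equivFin J).symm
  refine ⟨Fintype.card J, fun k => S (ε k),
    { pt := X
      π := fun k => p (ε k)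
      ι := fun k => i (ε k)
      ι_π := fun j k => ?_ }, fun k => (hS _).simple h, ⟨?_⟩, ⟨Iso.refl _⟩⟩
  · split_ifs with hjk
    · subst hjk
      simpa using h1 (ε j)
    · exact h2 _ _ fun h => hjk (ε.injective h)
  · refine isBilimitOfTotal _ ?_
    exact (Equiv.sum_comp ε fun j => p j ≫ i j).trans h3

/-- Semisimplicity passes through anti-equivalences. -/
lemma isSemisimpleCategory_of_antiEquivalence {E : Type*} [Category* E] [Preadditive E] [Linear ℂ C]
    [Linear ℂ E] (h : IsVonNeumannRegular C) (hA : ∃ A : Abelian C, A.toPreadditive = ‹Preadditive C›)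
    (hd : ∀ X : C, HasBrickDecomposition X) {G : Cᵒᵖ ⥤ E} (hG : IsAntiEquivalence G) :
    IsSemisimpleCategory E := by
  have := hG.isEquivalence
  have hadd : G.Additive := ⟨fun {X Y f g} => hG.map_add f.unop g.unop⟩
  have hreg : IsVonNeumannRegular E := fun X Y f => by
    obtain ⟨f', hf⟩ := G.map_surjective ((G.objObjPreimageIso X).hom ≫ f ≫ (G.objObjPreimageIso Y).inv)
    obtain ⟨g, hg⟩ := h f'.unop
    refine ⟨(G.objObjPreimageIso Y).inv ≫ G.map g.op ≫ (G.objObjPreimageIso X).hom, ?_⟩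
    have hf' : f = (G.objObjPreimageIso X).inv ≫ G.map f' ≫ (G.objObjPreimageIso Y).hom := by
      rw [hf]; simp
    have hg' : f' ≫ g.op ≫ f' = f' := by
      apply Quiver.Hom.unop_inj
      simpa using hg
    rw [hf']
    simp only [Category.assoc, Iso.hom_inv_id_assoc, ← G.map_comp_assoc]
    rw [hg']
  refine isSemisimpleCategory_of_bricks hreg ?_ fun Y => ?_
  -- Substituting the equality turns the given preadditive structure into that of `A`, so that the
  -- abelian structure transported to `E` carries the prescribed addition.
  · obtain ⟨A, rfl⟩ := hA
    have hfp : HasFiniteProducts E := ⟨fun n =>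
      Adjunction.hasLimitsOfShape_of_equivalence G.inv⟩
    exact ⟨abelianOfEquivalence G.inv, rfl⟩
  · obtain ⟨J, _, S, i, p, hS, h1, h2, h3⟩ := hd (G.objPreimage Y).unop
    let φ := G.objObjPreimageIso Y
    refine ⟨J, inferInstance, fun j => G.obj (Opposite.op (S j)), fun j => G.map (p j).op ≫ φ.hom,
      fun j => φ.inv ≫ G.map (i j).op, fun j => ⟨fun h0 => (hS j).1 ?_, fun e he => ?_⟩, fun j => ?_,
      fun j k hjk => ?_, ?_⟩
    · apply Quiver.Hom.op_inj
      apply G.map_injective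
      rw [op_id, G.map_id, h0]
      exact (G.map_zero _ _).symm
    · obtain ⟨e', rfl⟩ := G.map_surjective e
      rw [← G.map_comp] at he
      have := G.map_injective he
      rcases (hS j).2 e'.unop (congrArg Quiver.Hom.unop this) with h | h
      · left
        rw [show e' = 0 from Quiver.Hom.unop_inj h, G.map_zero]
      · right
        rw [show e' = 𝟙 _ from Quiver.Hom.unop_inj h, G.map_id]
    · simp only [Category.assoc, Iso.hom_inv_id_assoc, ← G.map_comp, ← op_comp, h1, op_id, G.map_id]
    · simp only [Category.assoc, Iso.hom_inv_id_assoc, ← G.map_comp, ← op_comp, h2 k j hjk.symm,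
        op_zero, G.map_zero]
    · have : ∑ j, G.map (i j).op ≫ G.map (p j).op = 𝟙 _ := by
        simp only [← G.map_comp, ← op_comp]
        rw [← G.map_sum, ← op_sum, h3, op_id, G.map_id]
      simp only [Category.assoc]
      simp only [← Category.assoc (G.map _)]
      rw [← Preadditive.comp_sum, ← Preadditive.sum_comp, this]
      simp

end Regular

/-! ### The category `⨁_d Rep(S_d)` -/

section RepSym

variable {d : ℕ} {X Y Z : RepSym d}

/-- The morphism of representations given by an equivariant linear map. -/
def homOfEquivariant (g : X →ₗ[ℂ] Y) (h : ∀ σ x, g (X.ρ σ x) = Y.ρ σ (g x)) : X ⟶ Y :=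
  ⟨InducedCategory.homMk (ModuleCat.ofHom g), fun σ => by
    ext x
    exact h σ x⟩

lemma toIntertwining_homOfEquivariant (g : X →ₗ[ℂ] Y) (h : ∀ σ x, g (X.ρ σ x) = Y.ρ σ (g x)) (x : X) :
    toIntertwining (homOfEquivariant g h) x = g x := rfl

lemma repSym_hom_ext {f g : X ⟶ Y} (h : ∀ x, toIntertwining f x = toIntertwining g x) : f = g := by
  ext x
  exact h x

lemma toIntertwining_comp (f : X ⟶ Y) (g : Y ⟶ Z) (x : X) :
    toIntertwining (f ≫ g) x = toIntertwining g (toIntertwining f x) := rfl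

/-- Project onto the range of `f`, then apply a linear section of `f` over its range. -/
lemma exists_linear_pseudoInverse {V W : Type*} [AddCommGroup V] [Module ℂ V] [AddCommGroup W]
    [Module ℂ W] (f : V →ₗ[ℂ] W) : ∃ g : W →ₗ[ℂ] V, ∀ v, f (g (f v)) = f v := by
  obtain ⟨s, hs⟩ := f.rangeRestrict.exists_rightInverse_of_surjective f.range_rangeRestrict
  obtain ⟨q, hq⟩ := f.range.subtype.exists_leftInverse_of_injective f.range.ker_subtype
  refine ⟨s ∘ₗ q, fun v => ?_⟩
  have h1 : q (f v) = f.rangeRestrict v := LinearMap.congr_fun hq (f.rangeRestrict v)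
  have h2 := LinearMap.congr_fun hs (f.rangeRestrict v)
  rw [LinearMap.comp_apply, h1]
  exact congrArg Subtype.val h2

/-- A form of Maschke's theorem. -/
lemma isVonNeumannRegular_repSym (d : ℕ) : IsVonNeumannRegular (RepSym d) := fun X Y f => by
  obtain ⟨g, hg⟩ := exists_linear_pseudoInverse (toIntertwining f).toLinearMap
  have hg' : ∀ x, toIntertwining f (g (toIntertwining f x)) = toIntertwining f x := hg
  let c : ℂ := (Fintype.card (Equiv.Perm (Fin d)) : ℂ)⁻¹
  let g' : Y →ₗ[ℂ] X := c • ∑ σ : Equiv.Perm (Fin d), X.ρ σ ∘ₗ g ∘ₗ Y.ρ σ⁻¹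
  have hg1 : ∀ y, g' y = c • ∑ σ : Equiv.Perm (Fin d), X.ρ σ (g (Y.ρ σ⁻¹ y)) := fun y => by
    simp [g', LinearMap.sum_apply]
  have heq : ∀ τ y, g' (Y.ρ τ y) = X.ρ τ (g' y) := fun τ y => by
    rw [hg1, hg1, map_smul, map_sum]
    congr 1
    refine Fintype.sum_equiv (Equiv.mulLeft τ⁻¹) _ _ fun σ => ?_
    change X.ρ σ (g (Y.ρ σ⁻¹ (Y.ρ τ y))) = X.ρ τ (X.ρ (τ⁻¹ * σ) (g (Y.ρ (τ⁻¹ * σ)⁻¹ y)))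
    rw [← Module.End.mul_apply, ← Module.End.mul_apply, ← map_mul, ← map_mul, mul_inv_rev, inv_inv,
      mul_inv_cancel_left]
  refine ⟨homOfEquivariant g' heq, repSym_hom_ext fun x => ?_⟩
  rw [toIntertwining_comp, toIntertwining_comp, toIntertwining_homOfEquivariant, hg1, map_smul, map_sum]
  -- Since `f` is equivariant, each conjugate of `g` is itself a pseudo-inverse of `f`; this is an
  -- affine condition, so it passes to the average.
  have h : ∀ σ : Equiv.Perm (Fin d),
      toIntertwining f (X.ρ σ (g (Y.ρ σ⁻¹ (toIntertwining f x)))) = toIntertwining f x := fun σ => by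
    have h1 : Y.ρ σ⁻¹ (toIntertwining f x) = toIntertwining f (X.ρ σ⁻¹ x) :=
      (Representation.IntertwiningMap.isIntertwining _ _ (toIntertwining f) _ _).symm
    rw [Representation.IntertwiningMap.isIntertwining, h1, hg',
      Representation.IntertwiningMap.isIntertwining, ← Module.End.mul_apply, ← map_mul,
      mul_inv_cancel, map_one, Module.End.one_apply]
  rw [Finset.sum_congr rfl fun σ _ => h σ, Finset.sum_const, Finset.card_univ,
    ← Nat.cast_smul_eq_nsmul ℂ, smul_smul, inv_mul_cancel₀, one_smul]
  exact Nat.cast_ne_zero.mpr Fintype.card_ne_zero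

instance (d : ℕ) : IsIdempotentComplete (RepSym d) :=
  (Idempotents.isIdempotentComplete_iff_hasEqualizer_of_id_and_idempotent _).mpr
    fun _ _ _ => inferInstance

instance (d : ℕ) : HasBinaryBiproducts (RepSym d) := HasBinaryBiproducts.of_hasBinaryProducts

lemma isZero_repSym_iff (X : RepSym d) : IsZero X ↔ ∀ x : X, x = 0 := by
  rw [IsZero.iff_id_eq_zero]
  constructor
  · intro h x
    have := congrArg (fun f => toIntertwining f x) h
    exact this
  · intro h
    exact repSym_hom_ext fun x => (h _).trans (h _).symm

end RepSym

/-- The support of a finitely supported family of representations. -/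
def degSupport (X : SumRepSym) : Finset ℕ := Set.Finite.toFinset X.property

lemma mem_degSupport {X : SumRepSym} {d : ℕ} : d ∈ degSupport X ↔ ¬ IsZero (X.obj d) :=
  Set.Finite.mem_toFinset _

lemma sumRepSym_hom_ext {X Y : SumRepSym} {f g : X ⟶ Y} (h : ∀ d, f.hom d = g.hom d) : f = g :=
  ObjectProperty.hom_ext _ (funext h)

/-- The morphism with the given components. -/
def sumRepSymHom {X Y : SumRepSym} (f : ∀ d, X.obj d ⟶ Y.obj d) : X ⟶ Y := ObjectProperty.homMk f

lemma isVonNeumannRegular_sumRepSym : IsVonNeumannRegular SumRepSym := fun X Y f => by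
  choose g hg using fun d => isVonNeumannRegular_repSym d (f.hom d)
  exact ⟨sumRepSymHom g, sumRepSym_hom_ext hg⟩

lemma isZero_of_retract {D : Type*} [Category* D] [Preadditive D] {A B : D} (i : A ⟶ B) (r : B ⟶ A)
    (h : i ≫ r = 𝟙 A) (hB : IsZero B) : IsZero A := by
  rw [IsZero.iff_id_eq_zero, ← h, hB.eq_of_tgt i 0, zero_comp]

/-- Idempotents split degree by degree, and the support stays finite because a retract of a zero
object is zero. -/
instance : IsIdempotentComplete SumRepSym where
  idempotents_split X e he := by
    choose A i r hir hri using fun d => IsIdempotentComplete.idempotents_split (X.obj d) (e.hom d)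
      (congrArg (fun f => f.hom d) he)
    refine ⟨⟨A, X.property.subset fun d hd hX => hd (isZero_of_retract (i d) (r d) (hir d) hX)⟩,
      sumRepSymHom i, sumRepSymHom r, sumRepSym_hom_ext hir, sumRepSym_hom_ext hri⟩

instance : HasZeroObject SumRepSym where
  zero := by
    refine ⟨⟨fun d => (HasZeroObject.zero' (RepSym d)).zero, ?_⟩, ?_⟩
    · refine Set.finite_empty.subset fun d hd => hd (isZero_zero _)
    · rw [IsZero.iff_id_eq_zero]
      exact sumRepSym_hom_ext fun d => (isZero_zero (RepSym d)).eq_of_src _ _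

instance : HasBinaryBiproducts SumRepSym where
  has_binary_biproduct X Y := by
    let Z : SumRepSym := ⟨fun d => X.obj d ⊞ Y.obj d, by
      refine (X.property.union Y.property).subset fun d hd => ?_
      by_contra h
      simp only [Set.mem_union, Set.mem_ofPred_eq, not_or, not_not] at h
      refine hd ?_
      rw [IsZero.iff_id_eq_zero, ← biprod.total, h.1.eq_of_tgt biprod.fst 0,
        h.2.eq_of_tgt biprod.snd 0]
      simp⟩
    let b : BinaryBicone X Y :=
      { pt := Z
        fst := sumRepSymHom (X := Z) fun d => biprod.fst
        snd := sumRepSymHom (X := Z) fun d => biprod.snd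
        inl := sumRepSymHom (Y := Z) fun d => biprod.inl
        inr := sumRepSymHom (Y := Z) fun d => biprod.inr
        inl_fst := sumRepSym_hom_ext fun d => biprod.inl_fst (X := X.obj d) (Y := Y.obj d)
        inl_snd := sumRepSym_hom_ext fun d => biprod.inl_snd (X := X.obj d) (Y := Y.obj d)
        inr_fst := sumRepSym_hom_ext fun d => biprod.inr_fst (X := X.obj d) (Y := Y.obj d)
        inr_snd := sumRepSym_hom_ext fun d => biprod.inr_snd (X := X.obj d) (Y := Y.obj d) }
    exact HasBinaryBiproduct.mk ⟨b, isBinaryBilimitOfTotal b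
      (sumRepSym_hom_ext fun d => biprod.total (X := X.obj d) (Y := Y.obj d))⟩

instance : HasFiniteProducts SumRepSym := hasFiniteProducts_of_has_binary_and_terminal

lemma sumRepSym_exists_abelian :
    ∃ A : Abelian SumRepSym, A.toPreadditive = (inferInstance : Preadditive SumRepSym) :=
  isVonNeumannRegular_sumRepSym.exists_abelian

/-- The total dimension of a finitely supported family of representations. -/
def totalDim (X : SumRepSym) : ℕ := ∑ d ∈ degSupport X, Module.finrank ℂ (X.obj d)

/-- A split inclusion is injective in every degree. If no dimension dropped, it would be bijective
in every degree and `r` would be its two-sided inverse. -/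
lemma totalDim_lt ⦃A X : SumRepSym⦄ (i : A ⟶ X) (r : X ⟶ A) (hir : i ≫ r = 𝟙 A) (hri : r ≫ i ≠ 𝟙 X) :
    totalDim A < totalDim X := by
  have hir' : ∀ d, i.hom d ≫ r.hom d = 𝟙 _ := fun d => congrArg (fun f => f.hom d) hir
  have hleft : ∀ d x, toIntertwining (r.hom d) (toIntertwining (i.hom d) x) = x := fun d x =>
    congrArg (fun f => toIntertwining f x) (hir' d)
  have hinj : ∀ d, Function.Injective (toIntertwining (i.hom d)).toLinearMap := fun d =>
    Function.LeftInverse.injective (g := toIntertwining (r.hom d)) (hleft d)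
  have hsub : degSupport A ⊆ degSupport X := fun d hd => by
    rw [mem_degSupport] at hd ⊢
    exact fun hX => hd (isZero_of_retract _ _ (hir' d) hX)
  have h1 : totalDim A = ∑ d ∈ degSupport X, Module.finrank ℂ (A.obj d) := by
    refine Finset.sum_subset hsub fun d _ hd => ?_
    rw [mem_degSupport, not_not, isZero_repSym_iff] at hd
    have : Subsingleton (A.obj d) := ⟨fun x y => (hd x).trans (hd y).symm⟩
    exact Module.finrank_zero_of_subsingleton
  rw [h1]
  refine Finset.sum_lt_sum (fun d _ => LinearMap.finrank_le_finrank_of_injective (hinj d)) ?_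
  by_contra hc
  push Not at hc
  refine hri (sumRepSym_hom_ext fun d => ?_)
  by_cases hd : d ∈ degSupport X
  · have hsurj := (LinearMap.injective_iff_surjective_of_finrank_eq_finrank
      (le_antisymm (LinearMap.finrank_le_finrank_of_injective (hinj d)) (hc d hd))).mp (hinj d)
    refine repSym_hom_ext fun x => ?_
    obtain ⟨a, rfl⟩ := hsurj x
    exact congrArg (toIntertwining (i.hom d)) (hleft d a)
  · rw [mem_degSupport, not_not] at hd
    exact hd.eq_of_src _ _

lemma sumRepSym_hasBrickDecomposition (X : SumRepSym) : HasBrickDecomposition X :=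
  hasBrickDecomposition_of_size totalDim totalDim_lt X

/-! ### Homomorphisms out of tensor powers -/

section TensorHom

variable {d d' : ℕ} {ι : Type}

/-- The basis vector `e_{w_1} ⊗ ⋯ ⊗ e_{w_d}`. -/
def tvec (w : Fin d → ι) : TPow ι d := PiTensorProduct.tprod ℂ fun k => Finsupp.single (w k) 1

/-- The basis of `(ℂ^N)^{⊗ d}` given by the tensors of standard basis vectors. -/
def tbasis (ι : Type) (d : ℕ) : Module.Basis (Fin d → ι) ℂ (TPow ι d) :=
  letI := Classical.decEq ι
  Basis.piTensorProduct fun _ : Fin d => (Finsupp.basisSingleOne : Module.Basis ι ℂ (ι →₀ ℂ))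

lemma tbasis_apply (w : Fin d → ι) : tbasis ι d w = tvec w := by
  classical
  rw [tbasis, Basis.piTensorProduct_apply, tvec]
  simp

lemma tbasis_repr_tvec [DecidableEq (Fin d → ι)] (u w : Fin d → ι) :
    (tbasis ι d).repr (tvec u) w = if u = w then 1 else 0 := by
  rw [← tbasis_apply, Module.Basis.repr_self, Finsupp.single_apply]

lemma permTPow_tvec (σ : Equiv.Perm (Fin d)) (w : Fin d → ι) :
    permTPow ι d σ (tvec w) = tvec fun k => w (σ⁻¹ k) :=
  permTPow_tprod σ _

lemma diagUnit_tvec [DecidableEq ι] (a : ι) (u : Fin d → ι) :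
    ⁅diagUnit a, tvec u⁆ = ((Finset.univ.filter fun k => u k = a).card : ℂ) • tvec u := by
  rw [lie_tpow, tvec, tensorDeriv_tprod, Finset.card_filter, Nat.cast_sum, Finset.sum_smul]
  refine Finset.sum_congr rfl fun k _ => ?_
  rw [diagUnit_single]
  split_ifs with h
  · rw [Function.update_eq_self (f := fun k => Finsupp.single (u k) (1 : ℂ)) k]; simp
  · rw [MultilinearMap.map_update_zero]; simp

lemma repr_diagUnit_lie [DecidableEq ι] (a : ι) (w : Fin d → ι) (s : TPow ι d) :
    (tbasis ι d).repr ⁅diagUnit a, s⁆ w =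
      ((Finset.univ.filter fun k => w k = a).card : ℂ) * (tbasis ι d).repr s w := by
  classical
  suffices (tbasis ι d).coord w ∘ₗ LieModule.toEnd ℂ (gl ι) (TPow ι d) (diagUnit a) =
      ((Finset.univ.filter fun k => w k = a).card : ℂ) • (tbasis ι d).coord w from
    LinearMap.congr_fun this s
  refine (tbasis ι d).ext fun u => ?_
  rw [LinearMap.comp_apply, LieModule.toEnd_apply_apply, tbasis_apply, diagUnit_tvec, map_smul,
    LinearMap.smul_apply, Module.Basis.coord_apply, tbasis_repr_tvec]
  split_ifs with h
  · rw [h]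
  · simp

/-- Homomorphisms of tensor powers preserve weights. -/
lemma weight_eq_of_repr_ne_zero [DecidableEq ι] (ψ : TPow ι d →ₗ⁅ℂ, gl ι⁆ TPow ι d') (u : Fin d → ι)
    (v : Fin d' → ι) (h : (tbasis ι d').repr (ψ (tvec u)) v ≠ 0) (a : ι) :
    (Finset.univ.filter fun k => v k = a).card = (Finset.univ.filter fun k => u k = a).card := by
  -- The coefficient at `v` of the diagonal unit applied to `ψ (tvec u)` is computed twice: by its
  -- action on the target, and by moving it through `ψ`.
  have h1 := repr_diagUnit_lie a v (ψ (tvec u))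
  rw [← LieModuleHom.map_lie, diagUnit_tvec, map_smul, map_smul, Finsupp.smul_apply, smul_eq_mul] at h1
  exact_mod_cast (mul_right_cancel₀ h h1).symm

/-- The degree is the sum of the multiplicities in the weight. As `ι` may be infinite, the sum runs
over a finite set containing both images. -/
lemma card_eq_of_weight_eq [DecidableEq ι] (u : Fin d → ι) (v : Fin d' → ι)
    (h : ∀ a, (Finset.univ.filter fun k => v k = a).card = (Finset.univ.filter fun k => u k = a).card) :
    d' = d := by
  have key : ∀ {n : ℕ} (x : Fin n → ι) (s : Finset ι), Finset.univ.image x ⊆ s →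
      n = ∑ a ∈ s, (Finset.univ.filter fun k => x k = a).card := fun {n} x s hs => by
    rw [← Finset.card_eq_sum_card_fiberwise (f := x) (s := Finset.univ) fun k _ =>
      hs (Finset.mem_image_of_mem x (Finset.mem_univ k)), Finset.card_univ, Fintype.card_fin]
  rw [key v (Finset.univ.image v ∪ Finset.univ.image u) Finset.subset_union_left,
    Finset.sum_congr rfl fun a _ => h a, ← key u _ Finset.subset_union_right]

/-- There are no nonzero homomorphisms between tensor powers of distinct degrees. -/
lemma tensorHom_eq_zero (hd : d' ≠ d) (ψ : TPow ι d →ₗ⁅ℂ, gl ι⁆ TPow ι d') (t : TPow ι d) :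
    ψ t = 0 := by
  classical
  suffices ψ.toLinearMap = 0 from LinearMap.congr_fun this t
  refine (tbasis ι d).ext fun u => (tbasis ι d').ext_elem fun v => ?_
  by_contra h
  rw [tbasis_apply, LinearMap.zero_apply, map_zero, Finsupp.zero_apply] at h
  exact hd (card_eq_of_weight_eq u v (weight_eq_of_repr_ne_zero ψ u v h))

/-- The matrix unit `E_{ab}`. -/
def matUnit (a b : ι) : gl ι :=
  ⟨Finsupp.lsingle a ∘ₗ Finsupp.lapply b, by
    refine (Set.finite_singleton (a, b)).subset fun p hp => ?_
    have hp' : Finsupp.single a ((Finsupp.single p.2 (1 : ℂ)) b) p.1 ≠ 0 := hp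
    by_contra h
    apply hp'
    by_cases h1 : a = p.1
    · by_cases h2 : p.2 = b
      · exact absurd (Prod.ext h1.symm h2) h
      · rw [Finsupp.single_eq_of_ne (Ne.symm h2), Finsupp.single_zero, Finsupp.zero_apply]
    · rw [Finsupp.single_eq_of_ne (Ne.symm h1)]⟩

lemma matUnit_single (a b i : ι) [Decidable (i = b)] :
    (matUnit a b).1 (Finsupp.single i 1) = if i = b then Finsupp.single a 1 else 0 := by
  change Finsupp.single a ((Finsupp.single i (1 : ℂ)) b) = _
  split_ifs with h
  · subst h; simp
  · rw [Finsupp.single_eq_of_ne (Ne.symm h), Finsupp.single_zero]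

/-- The index `w k` occurs only in position `k`, so a single term of the Leibniz sum survives. -/
lemma matUnit_lie_tvec (w : Fin d → ι) (k : Fin d) (a : ι) (hw : ∀ l, l ≠ k → w l ≠ w k) :
    ⁅matUnit a (w k), tvec w⁆ = tvec (Function.update w k a) := by
  classical
  rw [lie_tpow, tvec, tensorDeriv_tprod, Finset.sum_eq_single k]
  · rw [matUnit_single, if_pos rfl, tvec]
    congr 1
    funext j
    by_cases hj : j = k
    · subst hj; simp
    · simp [hj]
  · intro l _ hl
    rw [matUnit_single, if_neg (hw l hl), MultilinearMap.map_update_zero]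
  · simp

variable {M : Type} [AddCommGroup M] [Module ℂ M] [LieRingModule (gl ι) M]

/-- Matrix units replace the entries of `u` by those of `v` one position at a time. An entry of `u`
not yet replaced occurs exactly once, even if `v` has repetitions: this is where disjointness and
injectivity enter. -/
lemma hom_tvec_eq_zero_of_disjoint (ψ : TPow ι d →ₗ⁅ℂ, gl ι⁆ M) (u v : Fin d → ι)
    (hu : Function.Injective u) (huv : ∀ k l, u k ≠ v l) (h : ψ (tvec u) = 0) : ψ (tvec v) = 0 := by
  classical
  have key : ∀ s : Finset (Fin d), ψ (tvec (s.piecewise v u)) = 0 := fun s => by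
    induction s using Finset.induction_on with
    | empty => simpa using h
    | insert k s hk ih =>
      have hk' : s.piecewise v u k = u k := Finset.piecewise_eq_of_notMem _ _ _ hk
      rw [Finset.piecewise_insert, ← matUnit_lie_tvec, LieModuleHom.map_lie, ih, lie_zero]
      intro l hl
      rw [hk']
      by_cases hls : l ∈ s
      · rw [Finset.piecewise_eq_of_mem _ _ _ hls]
        exact (huv k l).symm
      · rw [Finset.piecewise_eq_of_notMem _ _ _ hls]
        exact fun h => hl (hu h)
  have := key Finset.univ
  rwa [Finset.piecewise_univ] at this

/-- The space `ℂ^N` is large with respect to the degree `d`. -/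
def IsLarge (ι : Type) (d : ℕ) : Prop := Nonempty (Fin (3 * d) ↪ ι)

lemma IsLarge.mono {d d' : ℕ} (h : IsLarge ι d) (hd : d' ≤ d) : IsLarge ι d' :=
  ⟨(Fin.castLEEmb (by omega)).trans h.some⟩

lemma isLarge_nat (d : ℕ) : IsLarge ℕ d := ⟨Fin.valEmbedding⟩

lemma isLarge_fin {n d : ℕ} (h : 3 * d ≤ n) : IsLarge (Fin n) d := ⟨Fin.castLEEmb h⟩

lemma IsLarge.exists_embedding (h : IsLarge ι d) (s : Finset ι) (hs : s.card ≤ 2 * d) :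
    ∃ w : Fin d ↪ ι, ∀ k, w k ∉ s := by
  classical
  let T : Finset ι := Finset.univ.map h.some
  have hT : T.card = 3 * d := by simp [T]
  have hcard : d ≤ (T \ s).card := by
    have := Finset.le_card_sdiff s T
    omega
  let ε := (T \ s).equivFin.symm
  refine ⟨(Fin.castLEEmb hcard).trans (ε.toEmbedding.trans (Function.Embedding.subtype _)), fun k => ?_⟩
  exact (Finset.mem_sdiff.mp (ε (Fin.castLE hcard k)).2).2

/-- If `N` is large, then `(ℂ^N)^{⊗ d}` is generated by any tensor of distinct basis vectors. -/
lemma hom_eq_zero_of_tvec (hι : IsLarge ι d) (ψ : TPow ι d →ₗ⁅ℂ, gl ι⁆ M) (w : Fin d → ι)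
    (hw : Function.Injective w) (h : ψ (tvec w) = 0) (t : TPow ι d) : ψ t = 0 := by
  classical
  suffices ψ.toLinearMap = 0 from LinearMap.congr_fun this t
  refine (tbasis ι d).ext fun u => ?_
  rw [tbasis_apply]
  -- Since `w` and `u` may overlap, one passes through an injective `v` disjoint from both. It
  -- avoids at most `2 * d` indices and needs `d` of its own, whence the bound `3 * d` in `IsLarge`.
  obtain ⟨v, hv⟩ := hι.exists_embedding (Finset.univ.image w ∪ Finset.univ.image u) (by
    refine (Finset.card_union_le _ _).trans ?_
    have h1 := Finset.card_image_le (s := Finset.univ) (f := w)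
    have h2 := Finset.card_image_le (s := Finset.univ) (f := u)
    rw [Finset.card_univ, Fintype.card_fin] at h1 h2
    omega)
  simp only [Finset.mem_union, Finset.mem_image, Finset.mem_univ, true_and, not_or, not_exists] at hv
  refine hom_tvec_eq_zero_of_disjoint ψ v u v.injective (fun k l h => (hv k).2 l h.symm) ?_
  exact hom_tvec_eq_zero_of_disjoint ψ w v hw (fun k l h => (hv l).1 k h) h

/-- Every `w k` occurs in `v`; choosing a position for each gives an injective self-map of `Fin d`,
hence a permutation. -/
lemma exists_perm_of_weight_eq [DecidableEq ι] (w v : Fin d → ι) (hw : Function.Injective w)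
    (h : ∀ a, (Finset.univ.filter fun k => v k = a).card = (Finset.univ.filter fun k => w k = a).card) :
    ∃ σ : Equiv.Perm (Fin d), v = fun k => w (σ⁻¹ k) := by
  have hsurj : ∀ k, ∃ l, v l = w k := fun k => by
    have h1 : 0 < (Finset.univ.filter fun l => v l = w k).card := by
      rw [h]
      exact Finset.card_pos.mpr ⟨k, by simp⟩
    obtain ⟨l, hl⟩ := Finset.card_pos.mp h1
    exact ⟨l, (Finset.mem_filter.mp hl).2⟩
  choose τ hτ using hsurj
  have hτi : Function.Injective τ := fun k l hkl => hw (by rw [← hτ k, ← hτ l, hkl])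
  let σ : Equiv.Perm (Fin d) := Equiv.ofBijective τ (Finite.injective_iff_bijective.mp hτi)
  refine ⟨σ, funext fun k => ?_⟩
  rw [← hτ]
  exact congrArg v (σ.apply_symm_apply k).symm

/-- A linear combination of permutations of the tensor factors. -/
def permHom (c : Equiv.Perm (Fin d) → ℂ) : TPow ι d →ₗ⁅ℂ, gl ι⁆ TPow ι d :=
  { ∑ σ, c σ • permTPow ι d σ with
    map_lie' := fun {A t} => by
      change (∑ σ, c σ • permTPow ι d σ) ⁅A, t⁆ = ⁅A, (∑ σ, c σ • permTPow ι d σ) t⁆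
      simp only [LinearMap.sum_apply, LinearMap.smul_apply, lie_tpow, map_sum, map_smul,
        permTPow_tensorDeriv] }

lemma permHom_apply (c : Equiv.Perm (Fin d) → ℂ) (t : TPow ι d) :
    permHom c t = ∑ σ, c σ • permTPow ι d σ t := by
  change (∑ σ, c σ • permTPow ι d σ) t = _
  simp only [LinearMap.sum_apply, LinearMap.smul_apply]

/-- The value at `tvec w` has the weight of `w`. As the entries of `w` are distinct, the basis
vectors of that weight are the permutations of `tvec w`, each arising from exactly one `σ`. -/
lemma hom_tvec_eq_sum (ψ : TPow ι d →ₗ⁅ℂ, gl ι⁆ TPow ι d) (w : Fin d → ι)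
    (hw : Function.Injective w) :
    ψ (tvec w) = ∑ σ : Equiv.Perm (Fin d),
      (tbasis ι d).repr (ψ (tvec w)) (fun k => w (σ⁻¹ k)) • permTPow ι d σ (tvec w) := by
  classical
  have hinj : ∀ σ τ : Equiv.Perm (Fin d), (fun k => w (σ⁻¹ k)) = (fun k => w (τ⁻¹ k)) → σ = τ :=
    fun σ τ h => inv_injective (Equiv.ext fun k => hw (congrFun h k))
  refine (tbasis ι d).ext_elem fun v => ?_
  rw [map_sum, Finsupp.finsetSum_apply]
  simp only [map_smul, Finsupp.smul_apply, permTPow_tvec, tbasis_repr_tvec, smul_eq_mul]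
  by_cases hv : ∃ σ : Equiv.Perm (Fin d), v = fun k => w (σ⁻¹ k)
  · obtain ⟨σ, rfl⟩ := hv
    rw [Finset.sum_eq_single σ]
    · simp
    · intro τ _ hτ
      rw [if_neg fun h => hτ (hinj _ _ h), mul_zero]
    · simp
  · rw [Finset.sum_eq_zero fun τ _ => by rw [if_neg fun h => hv ⟨τ, h.symm⟩, mul_zero]]
    by_contra h
    exact hv (exists_perm_of_weight_eq w v hw (weight_eq_of_repr_ne_zero ψ w v h))

/-- If `N` is large, then the endomorphisms of `(ℂ^N)^{⊗ d}` are the linear combinations of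
permutations. -/
lemma exists_eq_permHom (hι : IsLarge ι d) (ψ : TPow ι d →ₗ⁅ℂ, gl ι⁆ TPow ι d) :
    ∃ c : Equiv.Perm (Fin d) → ℂ, ∀ t, ψ t = ∑ σ, c σ • permTPow ι d σ t := by
  classical
  obtain ⟨w, -⟩ := hι.exists_embedding ∅ (by simp)
  refine ⟨fun σ => (tbasis ι d).repr (ψ (tvec w)) fun k => w (σ⁻¹ k), fun t => ?_⟩
  -- The difference of two homomorphisms that agree on the generator `tvec w` vanishes.
  have h := hom_eq_zero_of_tvec hι
    (ψ - permHom fun σ => (tbasis ι d).repr (ψ (tvec w)) fun k => w (σ⁻¹ k)) w w.injective (by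
      rw [LieModuleHom.sub_apply, permHom_apply, sub_eq_zero]
      exact hom_tvec_eq_sum ψ w w.injective) t
  rw [LieModuleHom.sub_apply, permHom_apply, sub_eq_zero] at h
  exact h

end TensorHom

/-! ### Homomorphisms between the spaces `Hom_{S_d}(X, (ℂ^N)^{⊗ d})` -/

section SWHom

variable {ι : Type} {d d' : ℕ}

lemma swSpace_ext {X : RepSym d} {f g : SWSpace ι X} (h : ∀ x, f x = g x) : f = g :=
  Representation.IntertwiningMap.ext (LinearMap.ext h)

lemma swSpace_map_perm {X : RepSym d} (f : SWSpace ι X) (σ : Equiv.Perm (Fin d)) (x : X) :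
    f (X.ρ σ x) = permTPow ι d σ (f x) :=
  Representation.IntertwiningMap.isIntertwining _ _ f σ x

lemma averageForm_apply (X : RepSym d) (l : X →ₗ[ℂ] ℂ) (t : TPow ι d) (x : X) :
    averageForm X l t x = (Fintype.card (Equiv.Perm (Fin d)) : ℂ)⁻¹ •
      ∑ σ : Equiv.Perm (Fin d), l (X.ρ σ⁻¹ x) • permTPow ι d σ t := by
  refine (average_apply X _ x).trans ?_
  congr 1
  refine Finset.sum_congr rfl fun σ _ => ?_
  exact map_smul (permTPow ι d σ) (l (X.ρ σ⁻¹ x)) t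

/-- The elements of `Hom_{S_d}(X, (ℂ^N)^{⊗ d})` separate the points of `X`. -/
lemma exists_swSpace_apply_ne_zero (X : RepSym d) (w : Fin d ↪ ι) {x : X} (hx : x ≠ 0) :
    ∃ f : SWSpace ι X, f x ≠ 0 := by
  classical
  obtain ⟨l, hl⟩ : ∃ l : X →ₗ[ℂ] ℂ, l x ≠ 0 := by
    by_contra! h
    exact hx ((Module.forall_dual_apply_eq_zero_iff ℂ x).mp h)
  refine ⟨averageForm X l (tvec w), fun h => hl ?_⟩
  have h : (∑ σ : Equiv.Perm (Fin d), l (X.ρ σ⁻¹ x) • permTPow ι d σ (tvec w)) = 0 :=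
    (smul_eq_zero.mp ((averageForm_apply X l (tvec w) x).symm.trans h)).resolve_left
      (inv_ne_zero (Nat.cast_ne_zero.mpr Fintype.card_ne_zero))
  -- Among the permutations of `tvec w` only `σ = 1` contributes to the coordinate `w`, so this
  -- coordinate of the sum is `l x`.
  have h1 := congrArg (fun t => (tbasis ι d).repr t w) h
  simp only [map_sum, map_smul, Finsupp.finsetSum_apply, Finsupp.smul_apply, permTPow_tvec,
    tbasis_repr_tvec, smul_eq_mul] at h1
  rw [Finset.sum_eq_single 1] at h1
  · simpa using h1
  · intro σ _ hσ
    rw [if_neg, mul_zero]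
    intro h
    refine hσ (inv_injective (Equiv.ext fun k => w.injective ?_))
    simpa using congrFun h k
  · simp

lemma swSpace_separates (X : RepSym d) (w : Fin d ↪ ι) {x y : X} (h : ∀ f : SWSpace ι X, f x = f y) :
    x = y := by
  by_contra hxy
  obtain ⟨f, hf⟩ := exists_swSpace_apply_ne_zero X w (sub_ne_zero.mpr hxy)
  exact hf (by rw [map_sub, h f, sub_self])

/-- By `sum_averageForm`, composing `φ` with averaging maps on the source and evaluations on the
target reduces the claim to homomorphisms between tensor powers of different degrees. -/
lemma swHom_eq_zero {Y : RepSym d} {X : RepSym d'} (hd : d' ≠ d)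
    (φ : SWSpace ι Y →ₗ⁅ℂ, gl ι⁆ SWSpace ι X) (f : SWSpace ι Y) : φ f = 0 := by
  refine swSpace_ext fun x => ?_
  rw [← sum_averageForm Y f]
  change (evalAt X x).comp φ _ = _
  rw [map_sum]
  refine Finset.sum_eq_zero fun k _ => ?_
  exact tensorHom_eq_zero hd (((evalAt X x).comp φ).comp
    (averageForm Y ((Module.finBasis ℂ Y).coord k))) (f (Module.finBasis ℂ Y k))

/-- Expanding `f` through its values on a basis `b_k` of `Y` writes `φ f x` as a sum of
endomorphisms of the tensor power applied to `f b_k`. These are combinations of permutations, which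
the equivariance of `f` moves onto the `b_k`. -/
lemma swHom_apply_eq (hι : IsLarge ι d) {X Y : RepSym d} (φ : SWSpace ι Y →ₗ⁅ℂ, gl ι⁆ SWSpace ι X)
    (x : X) : ∃ y : Y, ∀ f : SWSpace ι Y, φ f x = f y := by
  choose c hc using fun k => exists_eq_permHom hι (((evalAt X x).comp φ).comp
    (averageForm Y ((Module.finBasis ℂ Y).coord k)))
  refine ⟨∑ k, ∑ σ, c k σ • Y.ρ σ (Module.finBasis ℂ Y k), fun f => ?_⟩
  conv_lhs => rw [← sum_averageForm Y f]
  change (evalAt X x).comp φ _ = _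
  rw [map_sum, map_sum]
  refine Finset.sum_congr rfl fun k _ => ?_
  refine (hc k (f (Module.finBasis ℂ Y k))).trans ?_
  rw [map_sum]
  refine Finset.sum_congr rfl fun σ _ => ?_
  rw [map_smul, swSpace_map_perm]
  rfl

/-- If `N` is large, then the functor `Hom_{S_d}(·, (ℂ^N)^{⊗ d})` is full. -/
lemma exists_hom_of_swHom (hι : IsLarge ι d) {X Y : RepSym d}
    (φ : SWSpace ι Y →ₗ⁅ℂ, gl ι⁆ SWSpace ι X) :
    ∃ g : X ⟶ Y, ∀ f x, φ f x = f (toIntertwining g x) := by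
  obtain ⟨w, -⟩ := hι.exists_embedding ∅ (by simp)
  -- The vector `g x` is unique because the elements of `SWSpace ι Y` separate points; linearity and
  -- equivariance of `g` follow from this uniqueness.
  choose g hg using swHom_apply_eq hι φ
  refine ⟨homOfEquivariant
    { toFun := g
      map_add' := fun x y => swSpace_separates Y w fun f => ?_
      map_smul' := fun c x => swSpace_separates Y w fun f => ?_ }
    fun σ x => swSpace_separates Y w fun f => ?_, fun f x => hg x f⟩
  · rw [← hg, map_add, map_add, hg, hg]
  · rw [← hg, map_smul, map_smul, hg, RingHom.id_apply]
  · change f (g (X.ρ σ x)) = f (Y.ρ σ (g x))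
    rw [← hg, swSpace_map_perm, swSpace_map_perm, hg]

end SWHom

/-! ### The Schur–Weyl functor is fully faithful in small degrees -/

section SWFull

variable {ι : Type}

/-- The families of representations concentrated in degrees at most `D`. -/
def DegreeLE (D : ℕ) (X : SumRepSym) : Prop := ∀ d, D < d → IsZero (X.obj d)

lemma exists_degreeLE (X : SumRepSym) : ∃ D, DegreeLE D X := by
  refine ⟨(degSupport X).sup id, fun d hd => ?_⟩
  by_contra h
  exact absurd (Finset.le_sup (f := id) (mem_degSupport.mpr h)) (not_le.mpr hd)

/-- The Lie module homomorphism underlying a morphism of `Rep(𝔤𝔩_N)_poly`. -/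
def polyHom {M N : RepPoly ι} (f : M ⟶ N) : M.obj.carrier →ₗ⁅ℂ, gl ι⁆ N.obj.carrier := f.hom

lemma repPoly_hom_ext {M N : RepPoly ι} {f g : M ⟶ N} (h : ∀ m, polyHom f m = polyHom g m) : f = g :=
  ObjectProperty.hom_ext _ (LieModuleHom.ext h)

/-- The morphism of `Rep(𝔤𝔩_N)_poly` given by a Lie module homomorphism. -/
def polyMk {M N : RepPoly ι} (f : M.obj.carrier →ₗ⁅ℂ, gl ι⁆ N.obj.carrier) : M ⟶ N :=
  ObjectProperty.homMk f

lemma polyHom_polyMk {M N : RepPoly ι} (f : M.obj.carrier →ₗ⁅ℂ, gl ι⁆ N.obj.carrier) :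
    polyHom (polyMk f) = f := rfl

lemma polyHom_comp {M N K : RepPoly ι} (f : M ⟶ N) (g : N ⟶ K) (m : M.obj.carrier) :
    polyHom (f ≫ g) m = polyHom g (polyHom f m) := rfl

/-- The inclusion of the summand of degree `d`. -/
def swOf (ι : Type) (X : SumRepSym) (d : ℕ) :
    SWSpace ι (X.obj d) →ₗ⁅ℂ, gl ι⁆ ((SW ι).obj (Opposite.op X)).obj.carrier :=
  DirectSum.lieModuleOf ℂ ℕ (gl ι)
    (fun d => ((swDegree ι d).obj (Opposite.op (X.obj d))).carrier) d

/-- The projection to the summand of degree `d`. -/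
def swComp (ι : Type) (X : SumRepSym) (d : ℕ) :
    ((SW ι).obj (Opposite.op X)).obj.carrier →ₗ⁅ℂ, gl ι⁆ SWSpace ι (X.obj d) :=
  DirectSum.lieModuleComponent ℂ ℕ (gl ι)
    (fun d => ((swDegree ι d).obj (Opposite.op (X.obj d))).carrier) d

lemma swComp_swOf (X : SumRepSym) (d : ℕ) (f : SWSpace ι (X.obj d)) :
    swComp ι X d (swOf ι X d f) = f :=
  DirectSum.component.lof_self ℂ
    (M := fun d => ((swDegree ι d).obj (Opposite.op (X.obj d))).carrier) d f

lemma sw_ext {X : SumRepSym} {m m' : ((SW ι).obj (Opposite.op X)).obj.carrier}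
    (h : ∀ d, swComp ι X d m = swComp ι X d m') : m = m' :=
  DFinsupp.ext h

lemma sw_induction {X : SumRepSym} {P : ((SW ι).obj (Opposite.op X)).obj.carrier → Prop}
    (h0 : P 0) (hadd : ∀ m m', P m → P m' → P (m + m')) (hof : ∀ d f, P (swOf ι X d f))
    (m : ((SW ι).obj (Opposite.op X)).obj.carrier) : P m := by
  classical
  exact DirectSum.induction_on (motive := P)
    (β := fun d => ((swDegree ι d).obj (Opposite.op (X.obj d))).carrier) m h0 hof hadd

lemma swComp_map {X Y : SumRepSym} (g : X ⟶ Y) (m : ((SW ι).obj (Opposite.op Y)).obj.carrier) (d : ℕ)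
    (x : X.obj d) :
    swComp ι X d (polyHom ((SW ι).map g.op) m) x = swComp ι Y d m (toIntertwining (g.hom d) x) := rfl

lemma sw_hom_ext {X : SumRepSym} {M : RepPoly ι} {φ ψ : (SW ι).obj (Opposite.op X) ⟶ M}
    (h : ∀ d f, polyHom φ (swOf ι X d f) = polyHom ψ (swOf ι X d f)) : φ = ψ :=
  repPoly_hom_ext (sw_induction (by rw [map_zero, map_zero])
    (fun m m' h h' => by rw [map_add, map_add, h, h']) h)

/-- Only the target `Y` needs bounded degree: the points to be separated lie in `Y`, and above
degree `D` there is nothing to compare. -/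
lemma sw_faithful {D : ℕ} (hι : IsLarge ι D) {X Y : SumRepSym} (hY : DegreeLE D Y) {g h : X ⟶ Y}
    (hgh : (SW ι).map g.op = (SW ι).map h.op) : g = h := by
  refine sumRepSym_hom_ext fun d => ?_
  by_cases hd : D < d
  · exact (hY d hd).eq_of_tgt _ _
  obtain ⟨w, -⟩ := (hι.mono (not_lt.mp hd)).exists_embedding ∅ (by simp)
  refine repSym_hom_ext fun x => swSpace_separates _ w fun f => ?_
  rw [← swComp_swOf Y d f, ← swComp_map, ← swComp_map, hgh]

lemma sw_full {D : ℕ} (hι : IsLarge ι D) {X Y : SumRepSym} (hY : DegreeLE D Y)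
    (φ : (SW ι).obj (Opposite.op Y) ⟶ (SW ι).obj (Opposite.op X)) :
    ∃ g : X ⟶ Y, (SW ι).map g.op = φ := by
  have : ∀ d, ∃ g : X.obj d ⟶ Y.obj d, ∀ (f : SWSpace ι (Y.obj d)) (x : X.obj d),
      swComp ι X d (polyHom φ (swOf ι Y d f)) x = f (toIntertwining g x) := fun d => by
    by_cases hd : D < d
    -- Above degree `D` the source summand of `φ` vanishes, so the zero morphism will do.
    · refine ⟨0, fun f x => ?_⟩
      rw [swSpace_eq_zero _ (hY d hd) f, map_zero, map_zero, map_zero]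
      rfl
    · exact exists_hom_of_swHom (hι.mono (not_lt.mp hd))
        (((swComp ι X d).comp (polyHom φ)).comp (swOf ι Y d))
  choose g hg using this
  refine ⟨sumRepSymHom g, sw_hom_ext fun d f => sw_ext fun d' => ?_⟩
  by_cases hd : d' = d
  · subst hd
    refine swSpace_ext fun x => ?_
    rw [hg, swComp_map, swComp_swOf]
    rfl
  -- Off the diagonal both morphisms vanish, since their components go between different degrees.
  · refine Eq.trans ?_ (swHom_eq_zero hd (((swComp ι X d').comp (polyHom φ)).comp (swOf ι Y d)) f).symm
    exact swHom_eq_zero hd (((swComp ι X d').comp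
      (polyHom ((SW ι).map (sumRepSymHom g).op))).comp (swOf ι Y d)) f

end SWFull

/-! ### Polynomial representations of small degree lie in the essential image -/

section SWEssSurj

variable {ι : Type} {d D : ℕ}

instance : (SW ι).Additive where
  map_add {X _} f g := repPoly_hom_ext fun m => sw_ext fun d => swSpace_ext fun x =>
    map_add (swComp ι X.unop d m) (toIntertwining (f.unop.hom d) x) (toIntertwining (g.unop.hom d) x)

lemma sw_map_add {X Y : SumRepSym} (f g : X ⟶ Y) :
    (SW ι).map (f + g).op = (SW ι).map f.op + (SW ι).map g.op :=
  (SW ι).map_add (f := f.op) (g := g.op)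

lemma sw_map_smul {X Y : SumRepSym} (c : ℂ) (f : X ⟶ Y) :
    (SW ι).map (c • f).op = c • (SW ι).map f.op :=
  repPoly_hom_ext fun m => sw_ext fun d => swSpace_ext fun x =>
    map_smul (swComp ι Y d m) c (toIntertwining (f.hom d) x)

/-- The action of `S_d` on the functions on `S_d` by left translations. -/
def translation (d : ℕ) : Representation ℂ (Equiv.Perm (Fin d)) (Equiv.Perm (Fin d) → ℂ) where
  toFun σ := LinearMap.funLeft ℂ ℂ fun τ => σ⁻¹ * τ
  map_one' := LinearMap.ext fun f => funext fun τ => congrArg f (by simp)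
  map_mul' σ σ' := LinearMap.ext fun f => funext fun τ => congrArg f (by simp [mul_assoc])

/-- The regular representation of `S_d`. -/
def regRep (d : ℕ) : RepSym d := FDRep.of (translation d)

/-- Take `x` to be d! times the delta function at 1 and `l` the evaluation at 1. The factor d!
cancels the normalisation of the average. -/
lemma regRep_exists (d : ℕ) : ∃ (x : regRep d) (l : regRep d →ₗ[ℂ] ℂ),
    ∀ σ : Equiv.Perm (Fin d), l ((regRep d).ρ σ⁻¹ x) =
      if σ = 1 then (Fintype.card (Equiv.Perm (Fin d)) : ℂ) else 0 := by
  refine ⟨Pi.single (1 : Equiv.Perm (Fin d)) (Fintype.card (Equiv.Perm (Fin d)) : ℂ),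
    LinearMap.proj (φ := fun _ => ℂ) (1 : Equiv.Perm (Fin d)), fun σ => ?_⟩
  change Pi.single (M := fun _ => ℂ) (1 : Equiv.Perm (Fin d))
    (Fintype.card (Equiv.Perm (Fin d)) : ℂ) (σ⁻¹⁻¹ * 1) = _
  rw [Pi.single_apply, inv_inv, mul_one]

/-- The sum of the regular representations of `S_d`, `d ≤ D`. -/
def regSum (D : ℕ) : SumRepSym :=
  ⟨fun d => if d ≤ D then regRep d else (HasZeroObject.zero' (RepSym d)).zero, by
    refine (Set.finite_Iic D).subset fun d hd => ?_
    by_contra h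
    refine hd ?_
    change IsZero (if d ≤ D then regRep d else (HasZeroObject.zero' (RepSym d)).zero)
    rw [if_neg (show ¬ d ≤ D from h)]
    exact isZero_zero _⟩

lemma regSum_degreeLE (D : ℕ) : DegreeLE D (regSum D) := fun d hd => by
  change IsZero (if d ≤ D then regRep d else (HasZeroObject.zero' (RepSym d)).zero)
  rw [if_neg (not_le.mpr hd)]
  exact isZero_zero _

lemma regSum_exists (hd : d ≤ D) : ∃ (x : (regSum D).obj d) (l : (regSum D).obj d →ₗ[ℂ] ℂ),
    ∀ σ : Equiv.Perm (Fin d), l (((regSum D).obj d).ρ σ⁻¹ x) =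
      if σ = 1 then (Fintype.card (Equiv.Perm (Fin d)) : ℂ) else 0 := by
  have : (regSum D).obj d = regRep d := if_pos hd
  rw [this]
  exact regRep_exists d

/-- This reflects Hom_{S_d}(ℂ[S_d], T^d) ≅ T^d: evaluation at `x` undoes averaging against `l`, as
only `σ = 1` survives in the average. -/
lemma tpow_retract (ι : Type) (hd : d ≤ D) :
    ∃ (a : TPow ι d →ₗ⁅ℂ, gl ι⁆ ((SW ι).obj (Opposite.op (regSum D))).obj.carrier)
      (b : ((SW ι).obj (Opposite.op (regSum D))).obj.carrier →ₗ⁅ℂ, gl ι⁆ TPow ι d),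
      ∀ t, b (a t) = t := by
  obtain ⟨x, l, h⟩ := regSum_exists hd
  refine ⟨(swOf ι (regSum D) d).comp (averageForm _ l), (evalAt _ x).comp (swComp ι (regSum D) d),
    fun t => ?_⟩
  change swComp ι (regSum D) d (swOf ι (regSum D) d (averageForm _ l t)) x = t
  rw [swComp_swOf]
  refine (averageForm_apply _ l t x).trans ?_
  rw [Finset.sum_eq_single 1, h, if_pos rfl, map_one, Module.End.one_apply, smul_smul,
    inv_mul_cancel₀, one_smul]
  · exact Nat.cast_ne_zero.mpr Fintype.card_ne_zero
  · intro σ _ hσ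
    rw [h, if_neg hσ, zero_smul]
  · simp

instance : HasFiniteBiproducts SumRepSym := HasFiniteBiproducts.of_hasFiniteProducts

lemma DegreeLE.of_retract {A X : SumRepSym} (i : A ⟶ X) (r : X ⟶ A) (h : i ≫ r = 𝟙 A)
    (hX : DegreeLE D X) : DegreeLE D A := fun d hd =>
  isZero_of_retract (i.hom d) (r.hom d) (congrArg (fun f => f.hom d) h) (hX d hd)

lemma DegreeLE.biproduct {J : Type} [Fintype J] (X : SumRepSym) (hX : DegreeLE D X) :
    DegreeLE D (⨁ fun _ : J => X) := fun d hd => by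
  classical
  let Y : SumRepSym := ⨁ fun _ : J => X
  let ev : (Y ⟶ Y) →+ (Y.obj d ⟶ Y.obj d) :=
    { toFun := fun f => f.hom d
      map_zero' := rfl
      map_add' := fun _ _ => rfl }
  rw [IsZero.iff_id_eq_zero]
  change ev (𝟙 Y) = 0
  rw [← biproduct.total, map_sum]
  refine Finset.sum_eq_zero fun j _ => ?_
  change (biproduct.π (fun _ : J => X) j).hom d ≫ (biproduct.ι (fun _ : J => X) j).hom d = 0
  rw [(hX d hd).eq_of_tgt ((biproduct.π (fun _ : J => X) j).hom d) 0, zero_comp]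

lemma polyHom_sum {M N : RepPoly ι} {J : Type} (s : Finset J) (f : J → (M ⟶ N)) (m : M.obj.carrier) :
    polyHom (∑ j ∈ s, f j) m = ∑ j ∈ s, polyHom (f j) m := by
  let ev : (M ⟶ N) →+ N.obj.carrier :=
    { toFun := fun f => polyHom f m
      map_zero' := rfl
      map_add' := fun _ _ => rfl }
  exact map_sum ev f s

/-- A summand of a finite direct sum of tensor powers of degree at most `D` is in the image of the
Schur–Weyl functor if `N` is large. -/
lemma sw_essSurj (hι : IsLarge ι D) (M : RepPoly ι) {J : Type} [Fintype J] (d : J → ℕ)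
    (hd : ∀ j, d j ≤ D) (i : ∀ j, M.obj.carrier →ₗ⁅ℂ, gl ι⁆ TPow ι (d j))
    (p : ∀ j, TPow ι (d j) →ₗ⁅ℂ, gl ι⁆ M.obj.carrier) (h : ∀ m, ∑ j, p j (i j m) = m) :
    ∃ X : SumRepSym, DegreeLE D X ∧ Nonempty ((SW ι).obj (Opposite.op X) ≅ M) := by
  classical
  choose a b hab using fun j => tpow_retract ι (hd j)
  let R := regSum D
  let Y : SumRepSym := ⨁ fun _ : J => R
  have hY : DegreeLE D Y := DegreeLE.biproduct R (regSum_degreeLE D)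
  let α : ∀ j, M ⟶ (SW ι).obj (Opposite.op R) := fun j => polyMk ((a j).comp (i j))
  let β : ∀ j, (SW ι).obj (Opposite.op R) ⟶ M := fun j => polyMk ((p j).comp (b j))
  have hαβ : ∑ j, α j ≫ β j = 𝟙 M := repPoly_hom_ext fun m => by
    rw [polyHom_sum]
    refine Eq.trans (Finset.sum_congr rfl fun j _ => ?_) (h m)
    change p j (b j (a j (i j m))) = _
    rw [hab]
  let u : M ⟶ (SW ι).obj (Opposite.op Y) :=
    ∑ j, α j ≫ (SW ι).map (biproduct.π (fun _ : J => R) j).op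
  let v : (SW ι).obj (Opposite.op Y) ⟶ M :=
    ∑ j, (SW ι).map (biproduct.ι (fun _ : J => R) j).op ≫ β j
  have huv : u ≫ v = 𝟙 M := by
    rw [← hαβ, Preadditive.sum_comp]
    refine Finset.sum_congr rfl fun j _ => ?_
    rw [Preadditive.comp_sum, Finset.sum_eq_single j]
    · rw [Category.assoc, ← Category.assoc ((SW ι).map _), ← Functor.map_comp, ← op_comp,
        biproduct.ι_π_self, op_id, CategoryTheory.Functor.map_id, Category.id_comp]
    · intro k _ hk
      rw [Category.assoc, ← Category.assoc ((SW ι).map _), ← Functor.map_comp, ← op_comp,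
        biproduct.ι_π_ne _ hk, op_zero, Functor.map_zero, zero_comp, comp_zero]
    · simp
  -- `M` is a retract of the image of `Y`. The corresponding idempotent lifts to an idempotent of
  -- `Y`, and splitting it there produces the required object.
  obtain ⟨e, he⟩ := sw_full hι hY (v ≫ u)
  have hee : e ≫ e = e := sw_faithful hι hY (by
    rw [op_comp, Functor.map_comp, he, Category.assoc, reassoc_of% huv])
  obtain ⟨Z, s, r, hsr, hrs⟩ := IsIdempotentComplete.idempotents_split Y e hee
  refine ⟨Z, DegreeLE.of_retract s r hsr hY, ⟨⟨(SW ι).map r.op ≫ v, u ≫ (SW ι).map s.op, ?_, ?_⟩⟩⟩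
  · rw [Category.assoc, ← Category.assoc v, ← he, ← Functor.map_comp, ← Functor.map_comp, ← op_comp,
      ← op_comp, ← hrs, Category.assoc, Category.assoc, hsr, Category.comp_id, hsr, op_id,
      CategoryTheory.Functor.map_id]
  · rw [Category.assoc, ← Category.assoc ((SW ι).map _), ← Functor.map_comp, ← op_comp, hrs, he,
      Category.assoc, huv, Category.comp_id, huv]

end SWEssSurj

/-! ### The anti-equivalence for N = ∞, where every degree bound is admissible -/

lemma isAntiEquivalence_swInfty : IsAntiEquivalence SWInfty where
  isEquivalence :=
    { faithful := ⟨fun {X Y f g} h => by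
        obtain ⟨D, hD⟩ := exists_degreeLE X.unop
        exact Quiver.Hom.unop_inj (sw_faithful (isLarge_nat D) hD h)⟩
      full := ⟨fun {X Y} φ => by
        obtain ⟨D, hD⟩ := exists_degreeLE X.unop
        obtain ⟨g, hg⟩ := sw_full (isLarge_nat D) hD φ
        exact ⟨g.op, hg⟩⟩
      essSurj := ⟨fun M => by
        obtain ⟨J, _, d, i, p, h⟩ := M.property.exists_sum
        obtain ⟨X, -, hX⟩ := sw_essSurj (isLarge_nat _) M d
          (fun j => Finset.le_sup (f := d) (Finset.mem_univ j)) i p h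
        exact ⟨Opposite.op X, hX⟩⟩ }
  map_add := sw_map_add
  map_smul := sw_map_smul

/-! ### Bounds for the lengths of polynomial representations -/

section LengthUpper

variable {ι : Type}

/-- The homomorphisms from tensor powers to `M` that factor through the subobject `N`. -/
def factoringHoms (M : RepPoly ι) (s : Finset ℕ) (N : Subobject M) :
    Submodule ℂ (∀ d : s, TPow ι d →ₗ⁅ℂ, gl ι⁆ M.obj.carrier) where
  carrier := {g | ∀ d : s, ∃ h : TPow ι d →ₗ⁅ℂ, gl ι⁆ (N : RepPoly ι).obj.carrier,
    ∀ t, polyHom N.arrow (h t) = g d t}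
  zero_mem' d := ⟨0, fun t => map_zero (polyHom N.arrow)⟩
  add_mem' {g g'} hg hg' d := by
    obtain ⟨h, hh⟩ := hg d
    obtain ⟨h', hh'⟩ := hg' d
    exact ⟨h + h', fun t => by
      rw [LieModuleHom.add_apply, map_add, hh, hh', Pi.add_apply, LieModuleHom.add_apply]⟩
  smul_mem' c g hg d := by
    obtain ⟨h, hh⟩ := hg d
    exact ⟨c • h, fun t => by
      rw [LieModuleHom.smul_apply, map_smul, hh, Pi.smul_apply, LieModuleHom.smul_apply]⟩

lemma factoringHoms_mono (M : RepPoly ι) (s : Finset ℕ) : Monotone (factoringHoms M s) := by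
  intro N N' hN g hg d
  obtain ⟨h, hh⟩ := hg d
  refine ⟨(polyHom (Subobject.ofLE N N' hN)).comp h, fun t => ?_⟩
  rw [← hh, LieModuleHom.comp_apply, ← polyHom_comp, Subobject.ofLE_arrow]

/-- A subobject `N` is a summand of a sum of tensor powers, so it is recovered from the
homomorphisms into it: if each `p j` factors through `N'` inside `M`, these factorisations glue to a
map from `N` to `N'`. Degrees outside `s` contribute zero. -/
lemma le_of_factoringHoms_le (M : RepPoly ι) (s : Finset ℕ)
    (hs : ∀ d, d ∉ s → ∀ g : TPow ι d →ₗ⁅ℂ, gl ι⁆ M.obj.carrier, g = 0) (N N' : Subobject M)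
    (h : factoringHoms M s N ≤ factoringHoms M s N') : N ≤ N' := by
  classical
  obtain ⟨J, _, d, i, p, hip⟩ := (N : RepPoly ι).property.exists_sum
  have key : ∀ j, ∃ k : TPow ι (d j) →ₗ⁅ℂ, gl ι⁆ (N' : RepPoly ι).obj.carrier,
      ∀ t, polyHom N'.arrow (k t) = polyHom N.arrow (p j t) := fun j => by
    by_cases hj : d j ∈ s
    · have hmem : Pi.single (M := fun d : s => TPow ι d →ₗ⁅ℂ, gl ι⁆ M.obj.carrier) ⟨d j, hj⟩
          ((polyHom N.arrow).comp (p j)) ∈ factoringHoms M s N := by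
        intro d'
        by_cases hd : d' = ⟨d j, hj⟩
        · subst hd
          exact ⟨p j, fun t => by rw [Pi.single_eq_same]; rfl⟩
        · exact ⟨0, fun t => by
            rw [Pi.single_eq_of_ne hd]
            exact map_zero (polyHom N.arrow)⟩
      obtain ⟨k, hk⟩ := h hmem ⟨d j, hj⟩
      refine ⟨k, fun t => ?_⟩
      rw [hk, Pi.single_eq_same]
      rfl
    · refine ⟨0, fun t => ?_⟩
      have h0 := hs (d j) hj ((polyHom N.arrow).comp (p j))
      refine (map_zero (polyHom N'.arrow)).trans ?_
      exact (congrArg (fun g : TPow ι (d j) →ₗ⁅ℂ, gl ι⁆ M.obj.carrier => g t) h0).symm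
  choose k hk using key
  refine Subobject.le_of_comm (polyMk (∑ j, (k j).comp (i j))) (repPoly_hom_ext fun m => ?_)
  rw [polyHom_comp, polyHom_polyMk, lieModuleHom_sum_apply, map_sum]
  conv_rhs => rw [← hip m, map_sum]
  exact Finset.sum_congr rfl fun j _ => hk j (i j m)

/-- A chain of subobjects of `M` gives a strict chain of subspaces of ⨁ Hom(T^d, M), so its length
is at most the dimension. -/
lemma objectLength_le_finrank (M : RepPoly ι) (s : Finset ℕ)
    (hs : ∀ d, d ∉ s → ∀ g : TPow ι d →ₗ⁅ℂ, gl ι⁆ M.obj.carrier, g = 0)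
    [∀ d : s, Module.Finite ℂ (TPow ι d →ₗ⁅ℂ, gl ι⁆ M.obj.carrier)] :
    objectLength M ≤ ((∑ d : s, Module.finrank ℂ (TPow ι d →ₗ⁅ℂ, gl ι⁆ M.obj.carrier) : ℕ) : ℕ∞) := by
  have hmono : StrictMono fun N => Module.finrank ℂ (factoringHoms M s N) := fun N N' h =>
    Submodule.finrank_lt_finrank_of_lt (lt_of_le_of_ne (factoringHoms_mono M s h.le) fun he =>
      absurd (le_of_factoringHoms_le M s hs N' N he.ge) (not_le_of_gt h))
  refine (Order.height_le_height_apply_of_strictMono _ hmono ⊤).trans ?_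
  rw [Order.height_nat, ← Module.finrank_pi_fintype]
  exact_mod_cast Submodule.finrank_le _

variable {d : ℕ}

lemma tensorHom_sw_eq_zero (X : SumRepSym)
    (g : TPow ι d →ₗ⁅ℂ, gl ι⁆ ((SW ι).obj (Opposite.op X)).obj.carrier)
    (h : ∀ t, swComp ι X d (g t) = 0) : g = 0 := by
  refine LieModuleHom.ext fun t => sw_ext fun d' => ?_
  by_cases hd : d' = d
  · subst hd
    exact (h t).trans (map_zero (swComp ι X _)).symm
  · refine Eq.trans (swSpace_ext fun x => ?_) (map_zero (swComp ι X d')).symm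
    exact tensorHom_eq_zero hd ((evalAt (X.obj d') x).comp ((swComp ι X d').comp g)) t

/-- The endomorphism of `(ℂ^N)^{⊗ d}` obtained by evaluating a homomorphism to `SW(X)` at a vector. -/
def evalHom (X : SumRepSym) (g : TPow ι d →ₗ⁅ℂ, gl ι⁆ ((SW ι).obj (Opposite.op X)).obj.carrier)
    (x : X.obj d) : TPow ι d →ₗ⁅ℂ, gl ι⁆ TPow ι d :=
  (evalAt (X.obj d) x).comp ((swComp ι X d).comp g)

/-- Sending `g` to `x ↦ L (evalHom X g x)` embeds the homomorphisms into Hom(X_d, V). The map `L`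
records enough coordinates to detect equivariant endomorphisms; a good choice makes `V` independent
of N. -/
lemma finrank_tensorHom_sw_le (X : SumRepSym) {V : Type} [AddCommGroup V] [Module ℂ V]
    [FiniteDimensional ℂ V] (L : Module.End ℂ (TPow ι d) →ₗ[ℂ] V)
    (hL : ∀ ψ : TPow ι d →ₗ⁅ℂ, gl ι⁆ TPow ι d, L ψ.toLinearMap = 0 → ∀ t, ψ t = 0) :
    Module.Finite ℂ (TPow ι d →ₗ⁅ℂ, gl ι⁆ ((SW ι).obj (Opposite.op X)).obj.carrier) ∧
      Module.finrank ℂ (TPow ι d →ₗ⁅ℂ, gl ι⁆ ((SW ι).obj (Opposite.op X)).obj.carrier) ≤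
        Module.finrank ℂ (X.obj d) * Module.finrank ℂ V := by
  let Θ : (TPow ι d →ₗ⁅ℂ, gl ι⁆ ((SW ι).obj (Opposite.op X)).obj.carrier) →ₗ[ℂ] X.obj d →ₗ[ℂ] V :=
    LinearMap.mk₂ ℂ (fun g x => L (evalHom X g x).toLinearMap)
      (fun g g' x => (congrArg L (LinearMap.ext fun t => rfl)).trans
        (map_add L (evalHom X g x).toLinearMap (evalHom X g' x).toLinearMap))
      (fun c g x => (congrArg L (LinearMap.ext fun t => rfl)).trans
        (map_smul L c (evalHom X g x).toLinearMap))
      (fun g x y => (congrArg L (LinearMap.ext fun t => map_add (swComp ι X d (g t)) x y)).trans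
        (map_add L (evalHom X g x).toLinearMap (evalHom X g y).toLinearMap))
      (fun c g x => (congrArg L (LinearMap.ext fun t => map_smul (swComp ι X d (g t)) c x)).trans
        (map_smul L c (evalHom X g x).toLinearMap))
  have hΘ : Function.Injective Θ := by
    rw [injective_iff_map_eq_zero]
    intro g hg
    refine tensorHom_sw_eq_zero X g fun t => swSpace_ext fun x => ?_
    exact hL (evalHom X g x) (LinearMap.congr_fun hg x) t
  refine ⟨Module.Finite.of_injective Θ hΘ, ?_⟩
  rw [← Module.finrank_linearMap]
  exact LinearMap.finrank_le_finrank_of_injective hΘ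

lemma objectLength_sw_le (X : SumRepSym) (B : ℕ → ℕ)
    (h : ∀ d ∈ degSupport X, ∃ (V : Type) (_ : AddCommGroup V) (_ : Module ℂ V)
      (_ : FiniteDimensional ℂ V) (L : Module.End ℂ (TPow ι d) →ₗ[ℂ] V),
      (∀ ψ : TPow ι d →ₗ⁅ℂ, gl ι⁆ TPow ι d, L ψ.toLinearMap = 0 → ∀ t, ψ t = 0) ∧
        Module.finrank ℂ V = B d) :
    objectLength ((SW ι).obj (Opposite.op X)) ≤
      ((∑ d ∈ degSupport X, Module.finrank ℂ (X.obj d) * B d : ℕ) : ℕ∞) := by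
  have key : ∀ d ∈ degSupport X,
      Module.Finite ℂ (TPow ι d →ₗ⁅ℂ, gl ι⁆ ((SW ι).obj (Opposite.op X)).obj.carrier) ∧
        Module.finrank ℂ (TPow ι d →ₗ⁅ℂ, gl ι⁆ ((SW ι).obj (Opposite.op X)).obj.carrier) ≤
          Module.finrank ℂ (X.obj d) * B d := fun d hd => by
    obtain ⟨V, _, _, _, L, hL, hV⟩ := h d hd
    rw [← hV]
    exact finrank_tensorHom_sw_le X L hL
  have : ∀ d : degSupport X,
      Module.Finite ℂ (TPow ι d →ₗ⁅ℂ, gl ι⁆ ((SW ι).obj (Opposite.op X)).obj.carrier) :=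
    fun d => (key d d.2).1
  refine (objectLength_le_finrank _ (degSupport X) fun d hd g => ?_).trans ?_
  · rw [mem_degSupport, not_not] at hd
    exact tensorHom_sw_eq_zero X g fun t => swSpace_eq_zero _ hd _
  · rw [← Finset.sum_coe_sort (degSupport X)]
    exact_mod_cast Finset.sum_le_sum fun (d : degSupport X) _ => (key d d.2).2

lemma boundedLength_sw (X : SumRepSymᵒᵖ) : BoundedLength RepPolyFin Res (SWInvLim.obj X) := by
  classical
  induction X with | op X
  obtain ⟨D, hD⟩ := exists_degreeLE X
  -- For the finitely many `n < 3 * D` any finite bound suffices, so `L` may record all matrix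
  -- entries.
  have hsmall : ∀ n : ℕ, ∃ l : ℕ, objectLength ((SW (Fin n)).obj (Opposite.op X)) ≤ l := fun n =>
    ⟨_, objectLength_sw_le X (fun d => Module.finrank ℂ ((Fin d → Fin n) × (Fin d → Fin n) → ℂ))
      fun d _ => ⟨_, inferInstance, inferInstance, inferInstance, LinearMap.pi fun w =>
        (tbasis (Fin n) d).coord w.2 ∘ₗ LinearMap.applyₗ (tvec w.1), fun ψ h t => by
          suffices ψ.toLinearMap = 0 from LinearMap.congr_fun this t
          refine (tbasis (Fin n) d).ext fun u => (tbasis (Fin n) d).ext_elem fun v => ?_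
          rw [tbasis_apply, LinearMap.zero_apply, map_zero, Finsupp.zero_apply]
          exact congrFun h (u, v), rfl⟩⟩
  -- For large `n` an endomorphism is determined by the d! coordinates of its value at one `tvec w`,
  -- which gives a bound independent of `n`.
  have hlarge : ∀ n : ℕ, 3 * D ≤ n → objectLength ((SW (Fin n)).obj (Opposite.op X)) ≤
      ((∑ d ∈ degSupport X, Module.finrank ℂ (X.obj d) *
        Module.finrank ℂ (Equiv.Perm (Fin d) → ℂ) : ℕ) : ℕ∞) := fun n hn => by
    refine objectLength_sw_le X (fun d => Module.finrank ℂ (Equiv.Perm (Fin d) → ℂ)) fun d hd => ?_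
    have hdD : d ≤ D := by
      by_contra h
      exact mem_degSupport.mp hd (hD d (not_le.mp h))
    have hι := (isLarge_fin hn).mono hdD
    obtain ⟨w, -⟩ := hι.exists_embedding ∅ (by simp)
    let L : Module.End ℂ (TPow (Fin n) d) →ₗ[ℂ] Equiv.Perm (Fin d) → ℂ := LinearMap.pi fun σ =>
      (tbasis (Fin n) d).coord (fun k => w (σ⁻¹ k)) ∘ₗ LinearMap.applyₗ (tvec w)
    refine ⟨_, inferInstance, inferInstance, inferInstance, L, fun ψ h t => ?_, rfl⟩
    refine hom_eq_zero_of_tvec hι ψ w w.injective ?_ t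
    rw [hom_tvec_eq_sum ψ w w.injective]
    refine Finset.sum_eq_zero fun σ _ => ?_
    have h0 : (tbasis (Fin n) d).repr (ψ (tvec w)) (fun k => w (σ⁻¹ k)) = 0 := congrFun h σ
    rw [h0, zero_smul]
  choose l hl using hsmall
  refine ⟨(∑ d ∈ degSupport X, Module.finrank ℂ (X.obj d) *
    Module.finrank ℂ (Equiv.Perm (Fin d) → ℂ)) + ∑ n ∈ Finset.range (3 * D), l n, fun n => ?_⟩
  change objectLength ((SW (Fin n)).obj (Opposite.op X)) ≤ _
  by_cases hn : 3 * D ≤ n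
  · refine (hlarge n hn).trans ?_
    exact_mod_cast Nat.le_add_right _ _
  · refine (hl n).trans ?_
    have := Finset.single_le_sum (f := l) (fun _ _ => Nat.zero_le _)
      (Finset.mem_range.mpr (not_le.mp hn))
    exact_mod_cast this.trans (Nat.le_add_left _ _)

end LengthUpper

/-! ### Degrees of polynomial representations of `𝔤𝔩_n` -/

section Degrees

variable {n : ℕ}

/-- The identity matrix as an element of `𝔤𝔩_n`. -/
def euler (n : ℕ) : gl (Fin n) := ⟨1, Set.toFinite _⟩

lemma euler_lie_tpow {d : ℕ} (t : TPow (Fin n) d) : ⁅euler n, t⁆ = (d : ℂ) • t := by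
  suffices tensorDeriv d (1 : Module.End ℂ (Fin n →₀ ℂ)) = (d : ℂ) • LinearMap.id from
    LinearMap.congr_fun this t
  refine PiTensorProduct.ext (MultilinearMap.ext fun v => ?_)
  simp [tensorDeriv_tprod, Nat.cast_smul_eq_nsmul]

/-- The representation has a nonzero vector of degree `d`. -/
def HasDegree (M : RepPolyFin n) (d : ℕ) : Prop :=
  ∃ m : M.obj.carrier, m ≠ 0 ∧ ⁅euler n, m⁆ = (d : ℂ) • m

lemma euler_eq (n : ℕ) : euler (n + 1) = glIncl Fin.castSuccEmb (euler n) + diagUnit (Fin.last n) := by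
  refine Subtype.ext (Finsupp.lhom_ext' fun a => LinearMap.ext_ring ?_)
  change Finsupp.single a 1 = (glIncl Fin.castSuccEmb (euler n)).1 (Finsupp.single a 1) +
    (diagUnit (Fin.last n)).1 (Finsupp.single a 1)
  rw [diagUnit_single, glIncl_val]
  change Finsupp.single a 1 = incl Fin.castSuccEmb (proj Fin.castSuccEmb (Finsupp.single a 1)) + _
  induction a using Fin.lastCases with
  | last =>
    rw [proj_single_of_notMem, if_pos rfl, map_zero, zero_add]
    rintro ⟨k, hk⟩
    exact (Fin.castSucc_lt_last k).ne hk
  | cast k =>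
    rw [if_neg (Fin.castSucc_lt_last k).ne, add_zero]
    exact ((congrArg (incl Fin.castSuccEmb) (proj_single Fin.castSuccEmb k)).trans
      (incl_single Fin.castSuccEmb k)).symm

/-- The two identity matrices differ by the last diagonal unit, which lies in the complement 𝔤𝔩_n^⊥
and so kills the invariants. An invariant vector thus has the same degree at both levels. -/
lemma HasDegree.of_res {M : RepPolyFin (n + 1)} {N : RepPolyFin n} (φ : (Res n).obj M ≅ N) {d : ℕ}
    (h : HasDegree N d) : HasDegree M d := by
  obtain ⟨m, hm, hd⟩ := h
  let m' : invariants Fin.castSuccEmb M.obj.carrier := polyHom φ.inv m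
  have hinv : polyHom φ.hom m' = m := by
    change polyHom φ.hom (polyHom φ.inv m) = m
    rw [← polyHom_comp, φ.inv_hom_id]
    rfl
  have hm' : ⁅euler n, m'⁆ = (d : ℂ) • m' := by
    have h1 := LieModuleHom.map_lie (polyHom φ.inv) (euler n) m
    rw [hd, map_smul] at h1
    exact h1.symm
  refine ⟨m'.1, fun h0 => hm ?_, ?_⟩
  · rw [← hinv, show m' = 0 from Subtype.ext h0]
    exact map_zero (polyHom φ.hom)
  · rw [euler_eq, add_lie, m'.2 _ (diagUnit_mem _ _), add_zero]
    · exact congrArg Subtype.val hm'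
    · rintro ⟨k, hk⟩
      exact (Fin.castSucc_lt_last k).ne hk

/-- The image of an idempotent is a submodule which is a summand of `M`, hence again polynomial. -/
instance (ι : Type) : IsIdempotentComplete (RepPoly ι) where
  idempotents_split M e he := by
    obtain ⟨J, _, d, i, p, h⟩ := M.property.exists_sum
    have he' : ∀ m, polyHom e (polyHom e m) = polyHom e m := fun m =>
      congrArg (fun f => polyHom f m) he
    let K : LieSubmodule ℂ (gl ι) M.obj.carrier := (polyHom e).range
    have hK : ∀ m : K, polyHom e m.1 = m.1 := fun m => by
      obtain ⟨m', hm'⟩ := m.2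
      rw [← hm']
      exact he' m'
    let r : M.obj.carrier →ₗ⁅ℂ, gl ι⁆ K :=
      { toFun := fun m => ⟨polyHom e m, ⟨m, rfl⟩⟩
        map_add' := fun m m' => Subtype.ext (map_add (polyHom e) m m')
        map_smul' := fun c m => Subtype.ext (map_smul (polyHom e) c m)
        map_lie' := fun {A m} => Subtype.ext (LieModuleHom.map_lie (polyHom e) A m) }
    have hpoly : IsPolynomial ι ⟨K⟩ :=
      isPolynomial_of_sum _ d (fun j => (i j).comp K.incl) (fun j => r.comp (p j)) fun m => by
        change ∑ j, r (p j (i j m.1)) = m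
        rw [← map_sum, h]
        exact Subtype.ext (hK m)
    refine ⟨⟨⟨K⟩, hpoly⟩, polyMk (M := ⟨⟨K⟩, hpoly⟩) K.incl, polyMk (N := ⟨⟨K⟩, hpoly⟩) r, ?_, ?_⟩
    · exact repPoly_hom_ext fun m => Subtype.ext (hK m)
    · exact repPoly_hom_ext fun m => rfl

/-- A homomorphism to a tensor power of degree `d'` kills the vectors of degree `d ≠ d'`. -/
lemma hom_eq_zero_of_degree_ne {M : RepPolyFin n} {d d' : ℕ}
    (i : M.obj.carrier →ₗ⁅ℂ, gl (Fin n)⁆ TPow (Fin n) d')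
    {m : M.obj.carrier} (hm : ⁅euler n, m⁆ = (d : ℂ) • m) (hd : d' ≠ d) : i m = 0 := by
  have h : ((d : ℂ) - d') • i m = 0 := by
    refine (sub_smul (d : ℂ) d' (i m)).trans (sub_eq_zero.mpr ?_)
    rw [← map_smul, ← hm, LieModuleHom.map_lie, euler_lie_tpow]
  refine (smul_eq_zero.mp h).resolve_left fun h => hd ?_
  exact_mod_cast (sub_eq_zero.mp h).symm

lemma euler_lie_hom {M : RepPolyFin n} {d : ℕ} (p : TPow (Fin n) d →ₗ⁅ℂ, gl (Fin n)⁆ M.obj.carrier)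
    (t : TPow (Fin n) d) : ⁅euler n, p t⁆ = (d : ℂ) • p t := by
  rw [← LieModuleHom.map_lie, euler_lie_tpow, map_smul]

/-- The number of degrees of a polynomial representation is at most its length. -/
lemma card_le_objectLength (M : RepPolyFin n) (S : Finset ℕ) (hS : ∀ d ∈ S, HasDegree M d) :
    (S.card : ℕ∞) ≤ objectLength M := by
  classical
  obtain ⟨J, _, d, i, p, h⟩ := M.property.exists_sum
  -- `e T` is the projection onto the part of `M` with degrees in `T`: on a vector of degree `k` it
  -- is the identity if `k ∈ T` and zero otherwise.
  let e : Finset ℕ → (M ⟶ M) := fun T =>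
    polyMk (∑ j ∈ Finset.univ.filter (fun j => d j ∈ T), (p j).comp (i j))
  have he : ∀ T m, polyHom (e T) m = ∑ j ∈ Finset.univ.filter (fun j => d j ∈ T), p j (i j m) :=
    fun T m => lieModuleHom_sum_apply _ _ _
  have hmem : ∀ {T : Finset ℕ} {k : ℕ} {m : M.obj.carrier}, ⁅euler n, m⁆ = (k : ℂ) • m → k ∈ T →
      polyHom (e T) m = m := fun {T k m} hm hk => by
    rw [he, Finset.sum_filter]
    refine Eq.trans (Finset.sum_congr rfl fun j _ => ?_) (h m)
    split_ifs with hj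
    · rfl
    · rw [hom_eq_zero_of_degree_ne (i j) hm fun h => hj (h ▸ hk), map_zero]
  have hnotMem : ∀ {T : Finset ℕ} {k : ℕ} {m : M.obj.carrier}, ⁅euler n, m⁆ = (k : ℂ) • m → k ∉ T →
      polyHom (e T) m = 0 := fun {T k m} hm hk => by
    rw [he]
    refine Finset.sum_eq_zero fun j hj => ?_
    rw [hom_eq_zero_of_degree_ne (i j) hm fun h => hk (h ▸ (Finset.mem_filter.mp hj).2), map_zero]
  have hee : ∀ {T T' : Finset ℕ}, T ⊆ T' → e T ≫ e T' = e T := fun {T T'} hT =>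
    repPoly_hom_ext fun m => by
      rw [polyHom_comp, he T, map_sum]
      exact Finset.sum_congr rfl fun j hj =>
        hmem (euler_lie_hom (p j) (i j m)) (hT (Finset.mem_filter.mp hj).2)
  choose N a r har hra using fun T =>
    IsIdempotentComplete.idempotents_split M (e T) (hee (Finset.Subset.refl T))
  have hmono : ∀ T, Mono (a T) := fun T => (SplitMono.mk (r T) (har T)).mono
  let A : Finset ℕ → Subobject M := fun T => Subobject.mk (a T)
  have hlt : ∀ (T : Finset ℕ) (k : ℕ), k ∉ T → HasDegree M k → A T < A (insert k T) := by
    rintro T k hk ⟨m, hm0, hm⟩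
    refine lt_of_le_not_ge ?_ fun hle => hm0 ?_
    · refine Subobject.mk_le_mk_of_comm (a T ≫ r (insert k T)) ?_
      have h1 : a T ≫ e T = a T := by rw [← hra, reassoc_of% (har T)]
      rw [Category.assoc, hra, ← h1, Category.assoc, hee (Finset.subset_insert k T)]
    -- Were the inclusion an equality, `e T` would fix the image of `e (insert k T)`, which contains
    -- the nonzero vector `m` of degree `k ∉ T` that `e T` kills.
    · have h1 : e (insert k T) ≫ e T = e (insert k T) := by
        rw [← hra (insert k T), ← Subobject.ofMkLEMk_comp hle, Category.assoc, Category.assoc, ← hra T,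
          reassoc_of% (har T)]
      have h2 := congrArg (fun f => polyHom f m) h1
      simp only [polyHom_comp] at h2
      rwa [hmem hm (Finset.mem_insert_self k T), hnotMem hm hk, eq_comm] at h2
  have key : ∀ T : Finset ℕ, T ⊆ S → (T.card : ℕ∞) ≤ Order.height (A T) := fun T => by
    induction T using Finset.induction_on with
    | empty => simp
    | insert k T hk ih =>
      intro hT
      rw [Finset.card_insert_of_notMem hk, Nat.cast_add, Nat.cast_one]
      exact (add_le_add_left (ih ((Finset.subset_insert k T).trans hT)) 1).trans
        (Order.height_add_one_le (hlt T k hk (hS k (hT (Finset.mem_insert_self k T)))))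
  exact (key S (Finset.Subset.refl S)).trans (Order.height_mono le_top)

/-- Degrees persist as `n` grows, so any finite set of degrees occurring at various levels occurs at
one common level. Its size is then at most the length bound `l`, and `l + 1` degrees are impossible.
-/
lemma exists_degree_bound (M : InvLim RepPolyFin Res) (hM : BoundedLength RepPolyFin Res M) :
    ∃ D, ∀ n d, HasDegree (M.obj n) d → d ≤ D := by
  obtain ⟨l, hl⟩ := hM
  have hup : ∀ {m n : ℕ}, m ≤ n → ∀ {d}, HasDegree (M.obj m) d → HasDegree (M.obj n) d := by
    intro m n hmn d hd
    induction n, hmn using Nat.le_induction with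
    | base => exact hd
    | succ n _ ih => exact HasDegree.of_res (M.iso n) ih
  by_contra! hc
  have hinf : {d | ∃ n, HasDegree (M.obj n) d}.Infinite :=
    Set.infinite_of_not_bddAbove fun ⟨D, hD⟩ => by
      obtain ⟨n, d, hd, hlt⟩ := hc D
      exact absurd (hD ⟨n, hd⟩) (not_le.mpr hlt)
  obtain ⟨S, hS, hcard⟩ := hinf.exists_subset_card_eq (l + 1)
  choose! f hf using hS
  have h := (card_le_objectLength (M.obj (S.sup f)) S fun d hd =>
    hup (Finset.le_sup hd) (hf hd)).trans (hl _)
  rw [hcard] at h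
  have : l + 1 ≤ l := by exact_mod_cast h
  omega

/-- A presentation of `M` as a summand may involve tensor powers of degree above `D`, but these
contribute zero: a nonzero `p j (i j m)` would be a vector of degree `d j` in `M`. -/
lemma sw_essSurj_of_degree_le {D : ℕ} (hn : 3 * D ≤ n) (M : RepPolyFin n)
    (hM : ∀ d, HasDegree M d → d ≤ D) :
    ∃ X : SumRepSym, DegreeLE D X ∧ Nonempty ((SW (Fin n)).obj (Opposite.op X) ≅ M) := by
  classical
  obtain ⟨J, _, d, i, p, h⟩ := M.property.exists_sum
  refine sw_essSurj (isLarge_fin hn) M (J := {j // d j ≤ D}) (fun j => d j.1) (fun j => j.2)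
    (fun j => i j.1) (fun j => p j.1) fun m => ?_
  refine Eq.trans ?_ (h m)
  rw [← Finset.sum_subtype (Finset.univ.filter fun j => d j ≤ D) (by simp) fun j => p j (i j m),
    Finset.sum_filter_of_ne]
  intro j _ hj
  exact hM (d j) ⟨_, hj, euler_lie_hom (p j) (i j m)⟩

end Degrees

/-! ### Morphisms of inverse limits of categories -/

section InvLimHom

universe v u

variable {C : ℕ → Type u} [∀ n, Category.{v} (C n)] {F : ∀ n, C (n + 1) ⥤ C n} {X Y : InvLim C F}

lemma InvLim.hom_app_eq (f : X ⟶ Y) (n : ℕ) :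
    f.app n = (X.iso n).inv ≫ (F n).map (f.app (n + 1)) ≫ (Y.iso n).hom := by
  rw [f.comm, Iso.inv_hom_id_assoc]

/-- A morphism of the inverse limit is determined by its components of large index. -/
lemma InvLim.hom_ext_of_le {f g : X ⟶ Y} (N : ℕ) (h : ∀ n, N ≤ n → f.app n = g.app n) : f = g := by
  induction N with
  | zero => exact InvLim.hom_ext fun n => h n n.zero_le
  | succ N ih =>
    refine ih fun n hn => ?_
    rcases hn.eq_or_lt with rfl | hn
    · rw [InvLim.hom_app_eq f, InvLim.hom_app_eq g, h _ le_rfl]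
    · exact h n hn

lemma InvLim.isIso_of_app (f : X ⟶ Y) (h : ∀ n, IsIso (f.app n)) : IsIso f := by
  refine ⟨⟨⟨fun n => inv (f.app n), fun n => ?_⟩, InvLim.hom_ext fun n => IsIso.hom_inv_id _,
    InvLim.hom_ext fun n => IsIso.inv_hom_id _⟩⟩
  rw [Functor.map_inv, IsIso.inv_comp_eq, ← Category.assoc, f.comm, Category.assoc, IsIso.hom_inv_id,
    Category.comp_id]

/-- Compatible isomorphisms of the components of large index extend to an isomorphism of the inverse
limit. -/
lemma InvLim.nonempty_iso_of_le (N : ℕ) (φ : ∀ n, N ≤ n → (X.obj n ≅ Y.obj n))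
    (hφ : ∀ n hn, (F n).map (φ (n + 1) (hn.trans n.le_succ)).hom ≫ (Y.iso n).hom =
      (X.iso n).hom ≫ (φ n hn).hom) : Nonempty (X ≅ Y) := by
  induction N with
  | zero =>
    let f : X ⟶ Y := ⟨fun n => (φ n n.zero_le).hom, fun n => hφ n n.zero_le⟩
    have : IsIso f := InvLim.isIso_of_app f fun n => inferInstanceAs (IsIso (φ n n.zero_le).hom)
    exact ⟨asIso f⟩
  | succ N ih =>
    -- Compatibility forces the component at `N` to be the restriction of the one at `N + 1`.
    let ψ : X.obj N ≅ Y.obj N := (X.iso N).symm ≪≫ (F N).mapIso (φ (N + 1) le_rfl) ≪≫ Y.iso N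
    refine ih (fun n hn => if h : N + 1 ≤ n then φ n h else
      have hN : N = n := by omega
      hN ▸ ψ) fun n hn => ?_
    rcases hn.eq_or_lt with rfl | hn
    · rw [dif_pos le_rfl, dif_neg (by omega)]
      simp [ψ]
    · rw [dif_pos (show N + 1 ≤ n + 1 by omega), dif_pos (show N + 1 ≤ n by omega)]
      exact hφ n hn

end InvLimHom

/-! ### The functor to the restricted inverse limit -/

section SWLim

lemma swInvLim_iso_hom (X : SumRepSymᵒᵖ) (n : ℕ) :
    ((SWInvLim.obj X).iso n).hom = (swResIso (Fin.castSuccEmb (n := n))).hom.app X := rfl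

lemma swInvLim_map_app {X Y : SumRepSymᵒᵖ} (f : X ⟶ Y) (n : ℕ) :
    (SWInvLim.map f).app n = (SW (Fin n)).map f := rfl

lemma swInvLim_faithful {X Y : SumRepSym} {g h : X ⟶ Y} (hgh : SWInvLim.map g.op = SWInvLim.map h.op) :
    g = h := by
  obtain ⟨D, hD⟩ := exists_degreeLE Y
  exact sw_faithful (isLarge_fin (le_refl (3 * D))) hD
    (congrArg (fun f => InvLim.Hom.app f (3 * D)) hgh)

lemma swInvLim_full {X Y : SumRepSym}
    (φ : SWInvLim.obj (Opposite.op Y) ⟶ SWInvLim.obj (Opposite.op X)) :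
    ∃ g : X ⟶ Y, SWInvLim.map g.op = φ := by
  obtain ⟨D, hD⟩ := exists_degreeLE Y
  have hfull := fun n (hn : 3 * D ≤ n) => sw_full (isLarge_fin hn) hD (φ.app n)
  choose g hg using hfull
  -- Restricting the component at `n + 1` yields the one at `n`, while naturality of the restriction
  -- isomorphism turns restriction into the same morphism of families; faithfulness then makes the
  -- lifts independent of `n`.
  have hg' : ∀ n hn, g n hn = g (3 * D) le_rfl := fun n hn => by
    induction n, hn using Nat.le_induction with
    | base => rfl
    | succ n hn ih =>
      rw [← ih]
      refine sw_faithful (isLarge_fin hn) hD ?_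
      let τ := swResIso (Fin.castSuccEmb (n := n))
      refine Eq.trans ((cancel_epi (τ.hom.app (Opposite.op Y))).mp ?_) (hg n hn).symm
      exact (τ.hom.naturality (g (n + 1) _).op).symm.trans ((congrArg
        (fun ψ => (Res n).map ψ ≫ τ.hom.app (Opposite.op X)) (hg (n + 1) _)).trans (φ.comm n))
  refine ⟨g (3 * D) le_rfl, InvLim.hom_ext_of_le (3 * D) fun n hn => ?_⟩
  rw [swInvLim_map_app, ← hg n hn, hg' n hn]

lemma swInvLim_essSurj (M : InvLim RepPolyFin Res) (hM : BoundedLength RepPolyFin Res M) :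
    ∃ X : SumRepSym, Nonempty (SWInvLim.obj (Opposite.op X) ≅ M) := by
  obtain ⟨D, hD⟩ := exists_degree_bound M hM
  have hX := fun n (hn : 3 * D ≤ n) => sw_essSurj_of_degree_le hn (M.obj n) (hD n)
  choose X hX β using hX
  let N := 3 * D
  let X₀ := X N le_rfl
  have hX₀ : DegreeLE D X₀ := hX N le_rfl
  -- An isomorphism at level `n` extends compatibly to level `n + 1`, with the same `X₀`. An
  -- arbitrary isomorphism `b` at level `n + 1` need not be compatible and must be corrected.
  have step : ∀ n, N ≤ n → ∀ φ : (SW (Fin n)).obj (Opposite.op X₀) ≅ M.obj n,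
      ∃ ψ : (SW (Fin (n + 1))).obj (Opposite.op X₀) ≅ M.obj (n + 1),
        (Res n).map ψ.hom ≫ (M.iso n).hom =
          ((SWInvLim.obj (Opposite.op X₀)).iso n).hom ≫ φ.hom := fun n hn φ => by
    have hn' : 3 * D ≤ n + 1 := Nat.le_succ_of_le hn
    let b := (β (n + 1) hn').some
    let τ := swResIso (Fin.castSuccEmb (n := n))
    let X₁ := X (n + 1) hn'
    -- `χ` compares `X₀` and `X₁` through M_n and the restriction of `b`. It lifts to an isomorphism
    -- `ε` of families, and precomposing `b` with the image of `ε` cancels the defect.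
    let χ : (SW (Fin n)).obj (Opposite.op X₀) ≅ (SW (Fin n)).obj (Opposite.op X₁) :=
      φ ≪≫ (M.iso n).symm ≪≫ (Res n).mapIso b.symm ≪≫ τ.app (Opposite.op X₁)
    obtain ⟨f, hf⟩ := sw_full (isLarge_fin hn) hX₀ χ.hom
    obtain ⟨f', hf'⟩ := sw_full (isLarge_fin hn) (hX (n + 1) hn') χ.inv
    have h1 : f ≫ f' = 𝟙 _ := sw_faithful (isLarge_fin hn) (hX (n + 1) hn') (by
      rw [op_comp, Functor.map_comp, hf, hf', χ.inv_hom_id, op_id, CategoryTheory.Functor.map_id])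
    have h2 : f' ≫ f = 𝟙 _ := sw_faithful (isLarge_fin hn) hX₀ (by
      rw [op_comp, Functor.map_comp, hf, hf', χ.hom_inv_id, op_id, CategoryTheory.Functor.map_id])
    let ε : Opposite.op X₀ ≅ Opposite.op X₁ :=
      ⟨f.op, f'.op, by rw [← op_comp, h2, op_id], by rw [← op_comp, h1, op_id]⟩
    refine ⟨(SW (Fin (n + 1))).mapIso ε ≪≫ b, ?_⟩
    have hnat := τ.hom.naturality f.op
    rw [hf] at hnat
    have hnat' : (Res n).map ((SW (Fin (n + 1))).map f.op) =
        τ.hom.app (Opposite.op X₀) ≫ χ.hom ≫ τ.inv.app (Opposite.op X₁) := by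
      rw [← Category.assoc, ← hnat, Category.assoc, Iso.hom_inv_id_app, Category.comp_id]
      rfl
    rw [Iso.trans_hom, Functor.mapIso_hom, Functor.map_comp, hnat', swInvLim_iso_hom]
    have hχ : χ.hom ≫ τ.inv.app (Opposite.op X₁) = φ.hom ≫ (M.iso n).inv ≫ (Res n).map b.inv := by
      change χ.hom ≫ (τ.app (Opposite.op X₁)).inv = _
      simp only [χ, Iso.trans_hom, Category.assoc, Iso.hom_inv_id]
      exact congrArg (fun ψ => φ.hom ≫ (M.iso n).inv ≫ ψ) (Category.comp_id ((Res n).map b.inv))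
    rw [hχ]
    simp only [Category.assoc]
    rw [← Category.assoc ((Res n).map b.inv),
      ← Functor.map_comp, Iso.inv_hom_id, CategoryTheory.Functor.map_id, Category.id_comp,
      Iso.inv_hom_id, Category.comp_id]
    rfl
  choose ψ hψ using step
  -- The isomorphisms are chosen recursively from level `N` upwards, each extending the previous
  -- one; the levels below `N` are supplied by `InvLim.nonempty_iso_of_le`.
  let φ : ∀ n, N ≤ n → ((SW (Fin n)).obj (Opposite.op X₀) ≅ M.obj n) := fun n hn =>
    Nat.leRec (motive := fun n _ => (SW (Fin n)).obj (Opposite.op X₀) ≅ M.obj n)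
      (β N le_rfl).some (fun n hn φ => ψ n hn φ) hn
  refine ⟨X₀, InvLim.nonempty_iso_of_le N φ fun n hn => ?_⟩
  have h : φ (n + 1) (hn.trans n.le_succ) = ψ n hn (φ n hn) := Nat.leRec_succ _ _ hn
  exact (congrArg (fun ψ => (Res n).map ψ.hom ≫ (M.iso n).hom) h).trans (hψ n hn (φ n hn))

lemma isAntiEquivalence_swLim : IsAntiEquivalence
    ((BoundedLength RepPolyFin Res).lift SWInvLim boundedLength_sw) where
  isEquivalence :=
    { faithful := ⟨fun {_ _ _ _} h => Quiver.Hom.unop_inj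
        (swInvLim_faithful (congrArg (fun f => f.hom) h))⟩
      full := ⟨fun {_ _} φ => by
        obtain ⟨g, hg⟩ := swInvLim_full φ.hom
        exact ⟨g.op, ObjectProperty.hom_ext _ hg⟩⟩
      essSurj := ⟨fun M => by
        obtain ⟨X, ⟨φ⟩⟩ := swInvLim_essSurj M.obj M.property
        exact ⟨Opposite.op X, ⟨ObjectProperty.isoMk _ φ⟩⟩⟩ }
  map_add f g := ObjectProperty.hom_ext _ (InvLim.hom_ext fun _ => sw_map_add f g)
  map_smul c f := ObjectProperty.hom_ext _ (InvLim.hom_ext fun _ => sw_map_smul c f)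

end SWLim

end SchurWeyl

end

/-! ### The main theorem: semisimplicity and the two anti-equivalences -/

theorem mainTheorem7 :
    SchurWeyl.IsSemisimpleCategory SchurWeyl.SumRepSym ∧
    SchurWeyl.IsSemisimpleCategory (SchurWeyl.RepPoly ℕ) ∧
    SchurWeyl.IsSemisimpleCategory SchurWeyl.RestrRepPoly ∧
    SchurWeyl.IsAntiEquivalence SchurWeyl.SWInfty ∧
    ∃ h : ∀ X, SchurWeyl.BoundedLength SchurWeyl.RepPolyFin SchurWeyl.Res (SchurWeyl.SWInvLim.obj X),
      SchurWeyl.IsAntiEquivalence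
        ((SchurWeyl.BoundedLength SchurWeyl.RepPolyFin SchurWeyl.Res).lift SchurWeyl.SWInvLim h) :=
  ⟨SchurWeyl.isSemisimpleCategory_of_bricks SchurWeyl.isVonNeumannRegular_sumRepSym
      SchurWeyl.sumRepSym_exists_abelian SchurWeyl.sumRepSym_hasBrickDecomposition,
    SchurWeyl.isSemisimpleCategory_of_antiEquivalence SchurWeyl.isVonNeumannRegular_sumRepSym
      SchurWeyl.sumRepSym_exists_abelian SchurWeyl.sumRepSym_hasBrickDecomposition
      SchurWeyl.isAntiEquivalence_swInfty,
    SchurWeyl.isSemisimpleCategory_of_antiEquivalence SchurWeyl.isVonNeumannRegular_sumRepSym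
      SchurWeyl.sumRepSym_exists_abelian SchurWeyl.sumRepSym_hasBrickDecomposition
      SchurWeyl.isAntiEquivalence_swLim,
    SchurWeyl.isAntiEquivalence_swInfty, SchurWeyl.boundedLength_sw, SchurWeyl.isAntiEquivalence_swLim⟩
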